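/- Let $k>0$ be irrational and $c,g,\tau\in\mathbb R$. Functions on $\mathbb T^2=(\mathbb R/2\pi\mathbb Z)^2$ are called real analytic if they are real-valued sums of Fourier series $\sum_{j\in\mathbb Z^2}\hat u_{j}e^{i(j_1\alpha_1+j_2\alpha_2)}$ with $\hat u_{-j}=\overline{\hat u_j}$ and $|\hat u_j|\le Me^{-\sigma\max(|j_1|,|j_2|)}$ for some $M$ and some $\sigma>0$. For such a $\tilde u$, $u(\alpha)=\tilde u(\alpha,k\alpha)$ is a quasi-periodic function on $\mathbb R$. Write $$H[u](\alpha)=\frac1\pi\,\mathrm{PV}\!\int_{-\infty}^{\infty}\frac{u(s)}{\alpha-s}\,ds,\qquad H[\tilde u](\alpha_1,\alpha_2)=\sum_{j\in\mathbb Z^2}(-i)\,\mathrm{sgn}(j_1+j_2k)\,\hat u_je^{i(j_1\alpha_1+j_2\alpha_2)},$$ $P_0[u]=P_0[\tilde u]=\frac1{(2\pi)^2}\int_{\mathbb T^2}\tilde u\,d\alpha_1d\alpha_2$ (for all continuous $\tilde u$) and $P=\mathrm{id}-P_0$. *Equations of motion.* For a function $C_1(t)$, we say that $\zeta=\xi+i\eta$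 and $\varphi$ solve the equations of motion if $\eta$, $\varphi$, $\xi-\alpha$ and $\psi$ are, for each $t$, quasi-periodic with real analytic torus representation, $J\neq0$, and, for some $x_0(t)$, $$\xi=\alpha+x_0+H[\eta],\quad \xi_\alpha=1+H[\eta_\alpha],\quad \psi=-H[\varphi],\quad J=\xi_\alpha^2+\eta_\alpha^2,\quad \chi=\frac{\psi_\alpha}{J},\quad \kappa=\frac{\xi_\alpha\eta_{\alpha\alpha}-\eta_\alpha\xi_{\alpha\alpha}}{J^{3/2}},$$ $$\frac{dx_0}{dt}=P_0\big[\xi_\alpha(-H[\chi]+C_1)+\eta_\alpha\chi\big],\qquad \eta_t=-\eta_\alpha H[\chi]-\xi_\alpha\chi+C_1\eta_\alpha,$$ $$\varphi_t=P\Big[\frac{\psi_\alpha^2-\varphi_\alpha^2}{2J}-\varphi_\alpha H[\chi]+C_1\varphi_\alpha-g\eta+\tau\kappa\Big].\tag{1}$$ The torus version of (1) is the same system for $\tilde\zeta=\tilde\xi+i\tilde\eta$ and $\tilde\varphi$ on $\mathbb T^2$, with $\partial_\alpha$ replaced by $\partial_{\alpha_1}+k\partial_{\alpha_2}$, $H$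 by its torus version, $\xi_\alpha$ by $1+(\partial_{\alpha_1}+k\partial_{\alpha_2})\tilde\xi$, and $\tilde\xi=x_0+H[\tilde\eta]$. *Hypotheses.* Let $\tilde\eta_0$ be real analytic on $\mathbb T^2$ and satisfy the torus version (same replacements) of the traveling wave equations $$\xi_\alpha=1+H[\eta_\alpha],\quad J=\xi_\alpha^2+\eta_\alpha^2,\quad \kappa=\frac{\xi_\alpha\eta_{\alpha\alpha}-\eta_\alpha\xi_{\alpha\alpha}}{J^{3/2}},\quad P\Big[\frac{c^2}{2J}+g\eta-\tau\kappa\Big]=0 .$$ Put $\tilde\xi_0=H[\tilde\eta_0]$, $\tilde\zeta_0=\tilde\xi_0+i\tilde\eta_0$, $\tilde\varphi_0=c\,\tilde\xi_0$, $\zeta_0(\alpha;\theta)=\alpha+\tilde\zeta_0(\alpha,\theta+k\alpha)$ and $\varphi_0(\alpha;\theta)=\tilde\varphi_0(\alpha,\theta+k\alpha)$. Assume that for every $\theta\in[0,2\pi)$ the map $\alpha\mapsto\zeta_0(\alpha;\theta)$ is injective on $\mathbb R$ with $\partial_\alpha\zeta_0(\alpha;\theta)\ne0$ for all $\alpha\in\mathbb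 R$. *Conclusion.* Let $\alpha_0:\mathbb R\to\mathbb R$ be any continuously differentiable function. Then for every $\theta\in\mathbb R$ the functions $$\zeta(\alpha,t;\theta)=\zeta_0(\alpha-\alpha_0(t);\theta)+ct,\qquad \varphi(\alpha,t;\theta)=\varphi_0(\alpha-\alpha_0(t);\theta)$$ solve (1) for all $t\in\mathbb R$ with $C_1(t)=cP_0[\xi_\alpha/J]-\alpha_0'(t)$. Moreover, for the same $C_1$ (which does not depend on $\theta$, and also equals $cP_0\big[\widetilde{\xi_\alpha}/\tilde J\big]-\alpha_0'(t)$, where $\widetilde{\xi_\alpha}=1+(\partial_{\alpha_1}+k\partial_{\alpha_2})\tilde\xi$), the functions $$\tilde\zeta(\alpha_1,\alpha_2,t)=\tilde\zeta_0\big(\alpha_1-\alpha_0(t),\alpha_2-k\alpha_0(t)\big)+ct-\alpha_0(t),\qquad \tilde\varphi(\alpha_1,\alpha_2,t)=\tilde\varphi_0\big(\alpha_1-\alpha_0(t),\alpha_2-k\alpha_0(t)\big)$$ solve the torus version of (1), and they correspond to the functions above: $\zeta(\alpha,t;\theta)=\alpha+\tilde\zeta(\alpha,\theta+k\alpha,t)$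 and $\varphi(\alpha,t;\theta)=\tilde\varphi(\alpha,\theta+k\alpha,t)$. -/

import Mathlib

open Filter Topology

noncomputable section

namespace QPWave

/-! Functions on the torus `𝕋² = (ℝ / 2πℤ)²` are written as functions on `ℝ × ℝ`. -/

/-- The Fourier mode `e^{i (j₁ α₁ + j₂ α₂)}`. -/
def mode (j : ℤ × ℤ) (p : ℝ × ℝ) : ℂ :=
  Complex.exp (Complex.I * ((j.1 : ℂ) * (p.1 : ℂ) + (j.2 : ℂ) * (p.2 : ℂ)))

/-- The Fourier coefficient `(2π)⁻² ∫∫ u(α₁, α₂) e^{-i (j₁ α₁ + j₂ α₂)} dα₁ dα₂`. -/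
def torusCoeff (u : ℝ × ℝ → ℝ) (j : ℤ × ℤ) : ℂ :=
  (1 / (2 * (Real.pi : ℂ)) ^ 2) *
    ∫ x in (0 : ℝ)..(2 * Real.pi), ∫ y in (0 : ℝ)..(2 * Real.pi),
      (u (x, y) : ℂ) * mode (-j) (x, y)

/-- The torus version of `P₀`: the mean value over the torus. -/
def torusMean (u : ℝ × ℝ → ℝ) : ℝ :=
  (1 / (2 * Real.pi) ^ 2) *
    ∫ x in (0 : ℝ)..(2 * Real.pi), ∫ y in (0 : ℝ)..(2 * Real.pi), u (x, y)

/-- `2π`-periodicity in each of the two variables. -/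
def TorusPeriodic (u : ℝ × ℝ → ℝ) : Prop :=
  ∀ x y : ℝ, u (x + 2 * Real.pi, y) = u (x, y) ∧ u (x, y + 2 * Real.pi) = u (x, y)

/-- Real analytic real-valued functions on the torus: sums of Fourier series whose coefficients
have the reality symmetry and decay exponentially. -/
def TorusAnalytic (u : ℝ × ℝ → ℝ) : Prop :=
  ∃ (a : ℤ × ℤ → ℂ) (M σ : ℝ), 0 < σ ∧
    (∀ j, a (-j) = (starRingEnd ℂ) (a j)) ∧
    (∀ j, ‖a j‖ ≤ M * Real.exp (-σ * max |(j.1 : ℝ)| |(j.2 : ℝ)|)) ∧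
    ∀ p, HasSum (fun j => a j * mode j p) (u p : ℂ)

/-- `v = H[u]` for the torus version of the Hilbert transform, the Fourier multiplier with symbol
`-i sgn (j₁ + j₂ k)`; the convergence of the series is part of the assertion. -/
def IsTorusHilbert (k : ℝ) (u v : ℝ × ℝ → ℝ) : Prop :=
  ∀ p, HasSum
    (fun j : ℤ × ℤ => -Complex.I * (Real.sign ((j.1 : ℝ) + (j.2 : ℝ) * k) : ℂ) *
      torusCoeff u j * mode j p) (v p : ℂ)

/-- The torus version `∂_{α₁} + k ∂_{α₂}` of the `α`-derivative. -/
def torusDeriv (k : ℝ) (u : ℝ × ℝ → ℝ) (p : ℝ × ℝ) : ℝ := lineDeriv ℝ u p (1, k)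

/-- `v = H[u](α)` for the Hilbert transform on the line: the principal value
`(1/π) PV ∫ u(s) / (α - s) ds`, symmetric both at the singularity and at infinity, exists and
equals `v`. -/
def HasLineHilbert (u : ℝ → ℝ) (α v : ℝ) : Prop :=
  Tendsto
    (fun q : ℝ × ℝ => (1 / Real.pi) *
      ((∫ s in (α - q.2)..(α - q.1), u s / (α - s)) +
        ∫ s in (α + q.1)..(α + q.2), u s / (α - s)))
    (𝓝[>] (0 : ℝ) ×ˢ atTop) (𝓝 v)

/-- `u(α) = ũ(α, k α)` with `ũ` real analytic on the torus. -/
def QuasiPeriodic (k : ℝ) (u : ℝ → ℝ) : Prop :=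
  ∃ U : ℝ × ℝ → ℝ, TorusAnalytic U ∧ ∀ α, u α = U (α, k * α)

/-- `P₀[u] = m` for a quasi-periodic function `u(α) = ũ(α, k α)` with `ũ` continuous on the
torus: `m` is the mean value of `ũ` over the torus. -/
def HasMean (k : ℝ) (u : ℝ → ℝ) (m : ℝ) : Prop :=
  ∃ U : ℝ × ℝ → ℝ, Continuous U ∧ TorusPeriodic U ∧ (∀ α, u α = U (α, k * α)) ∧
    m = torusMean U

/-- Curvature of a plane curve from `ξ_α`, `η_α`, `ξ_αα`, `η_αα`. -/
def curvature (ξ₁ η₁ ξ₂ η₂ : ℝ) : ℝ :=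
  (ξ₁ * η₂ - η₁ * ξ₂) / (ξ₁ ^ 2 + η₁ ^ 2) ^ (3 / 2 : ℝ)

/-- The torus version of the traveling wave equations
`ξ_α = 1 + H[η_α]`, `J = ξ_α² + η_α²`, `κ = (ξ_α η_αα - η_α ξ_αα) / J^{3/2}`,
`P[c² / (2 J) + g η - τ κ] = 0`, where `P = id - P₀`. The function `X` is `ξ_α`. -/
def TorusTraveling (k c g τ : ℝ) (η : ℝ × ℝ → ℝ) : Prop :=
  ∃ X B : ℝ × ℝ → ℝ,
    IsTorusHilbert k (torusDeriv k η) (fun p => X p - 1) ∧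
    (∀ p, B p = c ^ 2 / (2 * (X p ^ 2 + torusDeriv k η p ^ 2)) + g * η p
      - τ * curvature (X p) (torusDeriv k η p) (torusDeriv k X p)
          (torusDeriv k (torusDeriv k η) p)) ∧
    ∀ p, B p - torusMean B = 0

/-- The equations of motion on the line, for `ξ`, `η`, `φ` as functions of `t` (first argument)
and `α` (second argument), with the auxiliary functions `x₀`, `ψ`, `J`, `χ`, `Hχ = H[χ]`, and `B`,
the function to which `P` is applied in the equation for `φ_t`. -/
structure LineSystem (k g τ : ℝ) (C₁ x₀ : ℝ → ℝ) (ξ η φ ψ J χ Hχ B : ℝ → ℝ → ℝ) : Prop where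
  quasi_xi : ∀ t, QuasiPeriodic k (fun α => ξ t α - α)
  quasi_eta : ∀ t, QuasiPeriodic k (η t)
  quasi_phi : ∀ t, QuasiPeriodic k (φ t)
  quasi_psi : ∀ t, QuasiPeriodic k (ψ t)
  /-- `ξ = α + x₀(t) + H[η]` -/
  xi_eq : ∀ t α, HasLineHilbert (η t) α (ξ t α - α - x₀ t)
  /-- `ξ_α = 1 + H[η_α]` -/
  xi_deriv : ∀ t α, HasLineHilbert (deriv (η t)) α (deriv (ξ t) α - 1)
  /-- `ψ = -H[φ]` -/
  psi_eq : ∀ t α, HasLineHilbert (φ t) α (-ψ t α)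
  J_eq : ∀ t α, J t α = deriv (ξ t) α ^ 2 + deriv (η t) α ^ 2
  J_ne : ∀ t α, J t α ≠ 0
  chi_eq : ∀ t α, χ t α = deriv (ψ t) α / J t α
  hchi_eq : ∀ t α, HasLineHilbert (χ t) α (Hχ t α)
  /-- `dx₀/dt = P₀[ξ_α V/s_α - η_α U/s_α]`, with `V/s_α = -H[χ] + C₁` and `U/s_α = -χ` -/
  x0_evol : ∀ t, ∃ m,
    HasMean k (fun α => deriv (ξ t) α * (-Hχ t α + C₁ t) - deriv (η t) α * (-χ t α)) m ∧
    HasDerivAt x₀ m t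
  eta_evol : ∀ t α, HasDerivAt (fun s => η s α)
    (-deriv (η t) α * Hχ t α - deriv (ξ t) α * χ t α + C₁ t * deriv (η t) α) t
  B_eq : ∀ t α, B t α =
    (deriv (ψ t) α ^ 2 - deriv (φ t) α ^ 2) / (2 * J t α) - deriv (φ t) α * Hχ t α
      + C₁ t * deriv (φ t) α - g * η t α
      + τ * curvature (deriv (ξ t) α) (deriv (η t) α) (deriv (deriv (ξ t)) α)
          (deriv (deriv (η t)) α)
  phi_evol : ∀ t, ∃ m, HasMean k (B t) m ∧
    ∀ α, HasDerivAt (fun s => φ s α) (B t α - m) t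

/-- `ζ = ξ + i η` and `φ` (time is the first argument) solve the equations of motion on the line
with the given `C₁`. -/
def SolvesLine (k g τ : ℝ) (C₁ : ℝ → ℝ) (ζ : ℝ → ℝ → ℂ) (φ : ℝ → ℝ → ℝ) : Prop :=
  ∃ (x₀ : ℝ → ℝ) (ψ J χ Hχ B : ℝ → ℝ → ℝ),
    LineSystem k g τ C₁ x₀ (fun t α => (ζ t α).re) (fun t α => (ζ t α).im) φ ψ J χ Hχ B

/-- The torus version of the equations of motion: `ξ` stands for the periodic part of the
horizontal component, so that `ξ_α` is replaced by `X = 1 + (∂_{α₁} + k ∂_{α₂}) ξ`. -/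
structure TorusSystem (k g τ : ℝ) (C₁ x₀ : ℝ → ℝ) (ξ η φ X ψ J χ Hχ B : ℝ → ℝ × ℝ → ℝ) :
    Prop where
  analytic_xi : ∀ t, TorusAnalytic (ξ t)
  analytic_eta : ∀ t, TorusAnalytic (η t)
  analytic_phi : ∀ t, TorusAnalytic (φ t)
  analytic_psi : ∀ t, TorusAnalytic (ψ t)
  /-- `ξ = x₀(t) + H[η]` -/
  xi_eq : ∀ t, IsTorusHilbert k (η t) (fun p => ξ t p - x₀ t)
  X_eq : ∀ t p, X t p = 1 + torusDeriv k (ξ t) p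
  xi_deriv : ∀ t, IsTorusHilbert k (torusDeriv k (η t)) (fun p => X t p - 1)
  /-- `ψ = -H[φ]` -/
  psi_eq : ∀ t, IsTorusHilbert k (φ t) (fun p => -ψ t p)
  J_eq : ∀ t p, J t p = X t p ^ 2 + torusDeriv k (η t) p ^ 2
  J_ne : ∀ t p, J t p ≠ 0
  chi_eq : ∀ t p, χ t p = torusDeriv k (ψ t) p / J t p
  hchi_eq : ∀ t, IsTorusHilbert k (χ t) (Hχ t)
  x0_evol : ∀ t, HasDerivAt x₀
    (torusMean (fun p => X t p * (-Hχ t p + C₁ t) - torusDeriv k (η t) p * (-χ t p))) t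
  eta_evol : ∀ t p, HasDerivAt (fun s => η s p)
    (-torusDeriv k (η t) p * Hχ t p - X t p * χ t p + C₁ t * torusDeriv k (η t) p) t
  B_eq : ∀ t p, B t p =
    (torusDeriv k (ψ t) p ^ 2 - torusDeriv k (φ t) p ^ 2) / (2 * J t p)
      - torusDeriv k (φ t) p * Hχ t p + C₁ t * torusDeriv k (φ t) p - g * η t p
      + τ * curvature (X t p) (torusDeriv k (η t) p) (torusDeriv k (X t) p)
          (torusDeriv k (torusDeriv k (η t)) p)
  phi_evol : ∀ t p, HasDerivAt (fun s => φ s p) (B t p - torusMean (B t)) t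

/-- `ζ̃ = ξ̃ + i η̃` and `φ̃` (time is the first argument) solve the torus version of the equations
of motion with the given `C₁`. -/
def SolvesTorus (k g τ : ℝ) (C₁ : ℝ → ℝ) (ζ : ℝ → ℝ × ℝ → ℂ) (φ : ℝ → ℝ × ℝ → ℝ) : Prop :=
  ∃ (x₀ : ℝ → ℝ) (X ψ J χ Hχ B : ℝ → ℝ × ℝ → ℝ),
    TorusSystem k g τ C₁ x₀ (fun t p => (ζ t p).re) (fun t p => (ζ t p).im) φ X ψ J χ Hχ B

/-- The curve `ζ(α; θ) = α + ζ̃(α, θ + k α)`. -/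
def lineCurve (k : ℝ) (ζ : ℝ × ℝ → ℂ) (θ α : ℝ) : ℂ := (α : ℂ) + ζ (α, θ + k * α)

/-- The function `φ(α; θ) = φ̃(α, θ + k α)`. -/
def lineFun (k : ℝ) (φ : ℝ × ℝ → ℝ) (θ α : ℝ) : ℝ := φ (α, θ + k * α)

/-- `ξ_α / J = ξ_α / (ξ_α² + η_α²)` for a curve `ζ = ξ + i η`. -/
def lineXiOverJ (ζ : ℝ → ℂ) (α : ℝ) : ℝ :=
  deriv (fun a => (ζ a).re) α /
    (deriv (fun a => (ζ a).re) α ^ 2 + deriv (fun a => (ζ a).im) α ^ 2)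

/-- The torus version of `ξ_α / J`, with `1 + (∂_{α₁} + k ∂_{α₂}) ξ̃` in place of `ξ_α`. -/
def torusXiOverJ (k : ℝ) (ζ : ℝ × ℝ → ℂ) (p : ℝ × ℝ) : ℝ :=
  (1 + torusDeriv k (fun q => (ζ q).re) p) /
    ((1 + torusDeriv k (fun q => (ζ q).re) p) ^ 2 + torusDeriv k (fun q => (ζ q).im) p ^ 2)

end QPWave

end

noncomputable section

namespace QPWave

open MeasureTheory
open scoped ContDiff BoundedContinuousFunction

/-! Write `ζ_α = ξ_α + i η_α` for the tangent of the profile. Since `ξ̃₀ = H[η̃₀]`, the function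
`ζ̃₀` contains only modes of frequency `j₁ + j₂ k ≤ 0`: along each line it is the boundary value of
a function holomorphic in the lower half-plane. The decisive fact is that `1 / ζ_α = (ξ_α - i η_α) /
J` also has only nonpositive frequencies (`exists_hasFourierSeries_inv`). Its real and imaginary
parts are then Hilbert conjugates, so `H[η_α / J] = m - ξ_α / J` with `m = P₀[ξ_α / J]`
(`HasFourierSeries.hilbert_im`).

The tangent being nonzero is not enough for this in general, because its holomorphic extension could
vanish inside the half-plane. Injectivity of the curves excludes that, by a homotopy in a Banach
algebra instead of the argument principle. The divided differences `(ζ(α + u) - ζ(α)) / u` are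
nowhere zero, tend to `1` as `u → ∞`, and equal `ζ_α` at `u = 0`. All lie in the closed algebra of
nonpositive frequencies, and the set of `u` at which the inverse lies there too is open, closed and
nonempty (`inverse_chordSlope_zero_mem`).

With `φ̃ = c ξ̃` this gives `ψ = c (η - P₀[η])`, `χ = c η_α / J` and `H[χ] = c (m - ξ_α / J)`. For
`C₁ = c m - α₀'` every equation of motion reduces to a pointwise identity: `η_t = -α₀' η_α`, `x₀' =
c - α₀'`, and the bracket in the equation for `φ_t` is a constant minus `α₀' φ_α` (`drift_eq`,
`kinematic_eq`, `dynamic_eq`).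

The system is verified on the torus and then restricted to lines. That restriction needs the
principal value on the line to agree with the Fourier multiplier, which follows mode by mode from
the Dirichlet integral (`HasFourierSeries.hasLineHilbert`). -/

/-! ### The sine integral and the Dirichlet integral. -/

/-- The sine integral. -/
def sineIntegral (x : ℝ) : ℝ := ∫ t in (0 : ℝ)..x, Real.sinc t

lemma sineIntegral_neg (x : ℝ) : sineIntegral (-x) = -sineIntegral x := by
  unfold sineIntegral
  have h := intervalIntegral.integral_comp_neg (a := 0) (b := x) Real.sinc
  simp only [Real.sinc_neg, neg_zero] at h
  rw [h, intervalIntegral.integral_symm]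

lemma integral_sinc (a b : ℝ) :
    ∫ t in a..b, Real.sinc t = sineIntegral b - sineIntegral a := by
  unfold sineIntegral
  rw [intervalIntegral.integral_interval_sub_left] <;>
    exact Real.continuous_sinc.intervalIntegrable _ _

lemma continuous_sineIntegral : Continuous sineIntegral :=
  intervalIntegral.continuous_primitive
    (fun a b => Real.continuous_sinc.intervalIntegrable a b) 0

lemma abs_sineIntegral_le (x : ℝ) : |sineIntegral x| ≤ |x| := by
  have h := intervalIntegral.norm_integral_le_of_norm_le_const (a := 0) (b := x) (C := 1)
    (f := Real.sinc) (fun t _ => Real.abs_sinc_le_one t)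
  simpa [sineIntegral] using h

lemma integral_sin_mul_exp_neg (y R : ℝ) :
    ∫ x in (0 : ℝ)..R, Real.sin x * Real.exp (-(x * y)) =
      (1 + y ^ 2)⁻¹ - Real.exp (-(R * y)) * (Real.cos R + y * Real.sin R) / (1 + y ^ 2) := by
  have hy : (1 + y ^ 2) ≠ 0 := by positivity
  have hd : ∀ x : ℝ, HasDerivAt
      (fun x => -(Real.exp (-(x * y)) * (Real.cos x + y * Real.sin x) / (1 + y ^ 2)))
      (Real.sin x * Real.exp (-(x * y))) x := by
    intro x
    have h1 : HasDerivAt (fun x => Real.exp (-(x * y))) (Real.exp (-(x * y)) * (-(1 * y))) x :=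
      (((hasDerivAt_id x).mul_const y).neg).exp
    have h2 : HasDerivAt (fun x => Real.cos x + y * Real.sin x)
        (-Real.sin x + y * Real.cos x) x :=
      (Real.hasDerivAt_cos x).add ((Real.hasDerivAt_sin x).const_mul y)
    refine ((h1.mul h2).div_const (1 + y ^ 2)).neg.congr_deriv ?_
    field_simp
    ring
  rw [intervalIntegral.integral_eq_sub_of_hasDerivAt (fun x _ => hd x)
    ((by fun_prop : Continuous fun x : ℝ =>
      Real.sin x * Real.exp (-(x * y))).intervalIntegrable _ _)]
  simp
  ring

/-- The hypothesis of Fubini's theorem for the next lemma: integrating the absolute value in `y`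
leaves `|sinc x|`, which is continuous on the bounded interval. -/
lemma integrable_sin_mul_exp_neg {R : ℝ} (hR : 0 < R) :
    Integrable (Function.uncurry fun x y : ℝ => Real.sin x * Real.exp (-(x * y)))
      ((volume.restrict (Set.uIoc 0 R)).prod (volume.restrict (Set.Ioi 0))) := by
  have hc : Continuous (Function.uncurry fun x y : ℝ => Real.sin x * Real.exp (-(x * y))) := by
    simp only [Function.uncurry_def]; fun_prop
  have hI : ∀ x : ℝ, 0 < x → ∫ y in Set.Ioi (0 : ℝ), Real.exp (-(x * y)) = x⁻¹ := by
    intro x hx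
    have := integral_exp_mul_Ioi (a := -x) (by linarith) 0
    simp only [neg_mul] at this
    rw [this]; simp
  have hi : ∀ x : ℝ, 0 < x → IntegrableOn (fun y => Real.exp (-(x * y))) (Set.Ioi (0 : ℝ)) := by
    intro x hx
    have := integrableOn_exp_mul_Ioi (a := -x) (by linarith) 0
    simpa only [neg_mul] using this
  rw [Set.uIoc_of_le hR.le]
  rw [integrable_prod_iff hc.aestronglyMeasurable]
  refine ⟨(ae_restrict_iff' measurableSet_Ioc).2 (ae_of_all _ fun x hx => ?_), ?_⟩
  · exact (hi x hx.1).const_mul (Real.sin x)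
  · have hb : IntegrableOn (fun x : ℝ => |Real.sinc x|) (Set.Ioc 0 R) :=
      (Real.continuous_sinc.abs.integrableOn_Icc).mono_set Set.Ioc_subset_Icc_self
    refine hb.congr_fun (fun x hx => ?_) measurableSet_Ioc
    have : ∀ y : ℝ, ‖Function.uncurry (fun x y : ℝ => Real.sin x * Real.exp (-(x * y))) (x, y)‖
        = |Real.sin x| * Real.exp (-(x * y)) := by
      intro y
      simp [Function.uncurry]
    simp only [this]
    rw [integral_const_mul, hI x hx.1, Real.sinc_of_ne_zero hx.1.ne', abs_div, abs_of_pos hx.1,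
      div_eq_mul_inv]

/-- Insert `1 / x = ∫ e^{-xy} dy` over `y > 0` and integrate in `x` first. The term `1 / (1 + y²)`
contributes `π / 2`, and the remainder is at most `2 ∫ e^{-Ry} dy = 2 / R`. -/
lemma abs_sineIntegral_sub_le {R : ℝ} (hR : 0 < R) :
    |sineIntegral R - Real.pi / 2| ≤ 2 / R := by
  have h1 : sineIntegral R =
      ∫ x in (0 : ℝ)..R, ∫ y in Set.Ioi (0 : ℝ), Real.sin x * Real.exp (-(x * y)) := by
    unfold sineIntegral
    rw [intervalIntegral.integral_of_le hR.le, intervalIntegral.integral_of_le hR.le]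
    refine setIntegral_congr_fun measurableSet_Ioc fun x hx => ?_
    have := integral_exp_mul_Ioi (a := -x) (by linarith [hx.1]) 0
    simp only [neg_mul] at this
    simp only [integral_const_mul]
    rw [this, Real.sinc_of_ne_zero hx.1.ne']
    simp [div_eq_mul_inv]
  rw [intervalIntegral_integral_swap (integrable_sin_mul_exp_neg hR)] at h1
  simp only [integral_sin_mul_exp_neg] at h1
  have hexp : IntegrableOn (fun y => Real.exp (-(R * y))) (Set.Ioi (0 : ℝ)) := by
    have := integrableOn_exp_mul_Ioi (a := -R) (by linarith) 0
    simpa only [neg_mul] using this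
  have hexpI : ∫ y in Set.Ioi (0 : ℝ), Real.exp (-(R * y)) = R⁻¹ := by
    have := integral_exp_mul_Ioi (a := -R) (by linarith) 0
    simp only [neg_mul] at this
    rw [this]; simp
  have hbd : ∀ y ∈ Set.Ioi (0 : ℝ),
      ‖Real.exp (-(R * y)) * (Real.cos R + y * Real.sin R) / (1 + y ^ 2)‖ ≤
        2 * Real.exp (-(R * y)) := by
    intro y hy
    have hy0 : (0 : ℝ) < y := hy
    have h2 : |Real.cos R + y * Real.sin R| ≤ 1 + y := by
      refine (abs_add_le _ _).trans (add_le_add (Real.abs_cos_le_one R) ?_)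
      rw [abs_mul, abs_of_pos hy0]
      exact mul_le_of_le_one_right hy0.le (Real.abs_sin_le_one R)
    rw [norm_div, norm_mul, Real.norm_eq_abs, Real.norm_eq_abs, Real.norm_eq_abs, Real.abs_exp,
      abs_of_pos (show 0 < 1 + y ^ 2 by positivity), div_le_iff₀ (by positivity)]
    have h3 : 1 + y ≤ 2 * (1 + y ^ 2) := by nlinarith [sq_nonneg (y - 1)]
    calc _ ≤ Real.exp (-(R * y)) * (2 * (1 + y ^ 2)) := by gcongr; exact h2.trans h3
      _ = _ := by ring
  have hint : IntegrableOn
      (fun y => Real.exp (-(R * y)) * (Real.cos R + y * Real.sin R) / (1 + y ^ 2))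
      (Set.Ioi (0 : ℝ)) := by
    refine Integrable.mono' (hexp.const_mul 2) ?_
      ((ae_restrict_iff' measurableSet_Ioi).2 (ae_of_all _ hbd))
    refine Continuous.aestronglyMeasurable ?_
    exact Continuous.div (by fun_prop) (by fun_prop) (fun y => by positivity)
  rw [integral_sub integrable_inv_one_add_sq.integrableOn hint, integral_Ioi_inv_one_add_sq,
    Real.arctan_zero] at h1
  rw [h1]
  have h4 := norm_integral_le_of_norm_le (hexp.const_mul 2)
    ((ae_restrict_iff' measurableSet_Ioi).2 (ae_of_all _ hbd))
  rw [integral_const_mul, hexpI, Real.norm_eq_abs] at h4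
  refine le_of_eq_of_le ?_ (h4.trans_eq (div_eq_mul_inv 2 R).symm)
  rw [← abs_neg]
  congr 1
  ring

lemma tendsto_sineIntegral_atTop : Tendsto sineIntegral atTop (𝓝 (Real.pi / 2)) := by
  rw [tendsto_iff_norm_sub_tendsto_zero]
  refine squeeze_zero' (Eventually.of_forall fun _ => norm_nonneg _)
    ((eventually_gt_atTop 0).mono fun R hR => abs_sineIntegral_sub_le hR) ?_
  exact tendsto_const_nhds.div_atTop tendsto_id

/-- A bound uniform in `x`, hence in the frequency, is what dominated convergence over the modes
requires. Up to `4` it comes from `|sinc| ≤ 1`; beyond, the value is within `1` of `π / 2`. -/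
lemma abs_sineIntegral_le_four (x : ℝ) : |sineIntegral x| ≤ 4 := by
  have key : ∀ x : ℝ, 0 ≤ x → |sineIntegral x| ≤ 4 := by
    intro x hx
    rcases le_total x 4 with h | h
    · exact (abs_sineIntegral_le x).trans (by rwa [abs_of_nonneg hx])
    · have h1 := abs_sineIntegral_sub_le (R := x) (by linarith)
      have h2 : 2 / x ≤ 1 := by rw [div_le_one (by linarith)]; linarith
      rw [abs_le] at h1 ⊢
      have := Real.pi_pos
      have := Real.pi_le_four
      constructor <;> linarith [h1.1, h1.2]
  rcases le_total 0 x with h | h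
  · exact key x h
  · have := key (-x) (by linarith)
    rwa [sineIntegral_neg, abs_neg] at this

lemma integral_sin_mul_div {r : ℝ} {ε R : ℝ} (hε : 0 < ε) (hR : ε ≤ R) :
    ∫ x in ε..R, Real.sin (r * x) / x = sineIntegral (r * R) - sineIntegral (r * ε) := by
  rw [← integral_sinc, ← intervalIntegral.mul_integral_comp_mul_left,
    ← intervalIntegral.integral_const_mul]
  refine intervalIntegral.integral_congr fun x hx => ?_
  rw [Set.uIcc_of_le hR] at hx
  have hx0 : x ≠ 0 := (hε.trans_le hx.1).ne'
  rcases eq_or_ne r 0 with rfl | hr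
  · simp
  · rw [Real.sinc_of_ne_zero (mul_ne_zero hr hx0)]
    field_simp

/-- The source of the factor `sgn` in the symbol of the Hilbert transform. -/
lemma tendsto_sineIntegral_sub (r : ℝ) :
    Tendsto (fun q : ℝ × ℝ => sineIntegral (r * q.2) - sineIntegral (r * q.1))
      (𝓝[>] (0 : ℝ) ×ˢ atTop) (𝓝 (Real.sign r * (Real.pi / 2))) := by
  have h1 : Tendsto (fun q : ℝ × ℝ => sineIntegral (r * q.1)) (𝓝[>] (0 : ℝ) ×ˢ atTop) (𝓝 0) := by
    have : Tendsto (fun e : ℝ => sineIntegral (r * e)) (𝓝[>] (0 : ℝ)) (𝓝 0) := by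
      have h := ((continuous_sineIntegral.comp (continuous_const_mul r)).tendsto 0).mono_left
        (nhdsWithin_le_nhds (s := Set.Ioi 0))
      have h0 : sineIntegral 0 = 0 := by simp [sineIntegral]
      simpa [h0, Function.comp_def] using h
    exact this.comp tendsto_fst
  have h2 : Tendsto (fun R : ℝ => sineIntegral (r * R)) atTop
      (𝓝 (Real.sign r * (Real.pi / 2))) := by
    rcases lt_trichotomy r 0 with hr | rfl | hr
    · rw [Real.sign_of_neg hr]
      have : Tendsto (fun R : ℝ => -r * R) atTop atTop :=
        tendsto_id.const_mul_atTop (by linarith)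
      have h := (tendsto_sineIntegral_atTop.comp this).neg
      simpa [Function.comp_def, sineIntegral_neg] using h
    · simp [sineIntegral]
    · rw [Real.sign_of_pos hr, one_mul]
      exact tendsto_sineIntegral_atTop.comp (tendsto_id.const_mul_atTop hr)
  simpa using (h2.comp tendsto_snd).sub h1

/-! ### Modes and their frequencies along the line. -/

/-- The frequency `j₁ + j₂ k` of a mode along the line. -/
def freq (k : ℝ) (j : ℤ × ℤ) : ℝ := (j.1 : ℝ) + (j.2 : ℝ) * k

@[simp] lemma freq_zero (k : ℝ) : freq k 0 = 0 := by simp [freq]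

lemma freq_neg (k : ℝ) (j : ℤ × ℤ) : freq k (-j) = -freq k j := by
  simp [freq]; ring

lemma freq_add (k : ℝ) (j l : ℤ × ℤ) : freq k (j + l) = freq k j + freq k l := by
  simp [freq]; ring

/-- This is where irrationality of `k` enters: the only mode killed by the Hilbert transform is the
constant one. -/
lemma freq_eq_zero {k : ℝ} (hk : Irrational k) {j : ℤ × ℤ} : freq k j = 0 ↔ j = 0 := by
  refine ⟨fun h => ?_, fun h => by simp [h]⟩
  obtain ⟨m, n⟩ := j
  simp only [freq] at h
  by_cases hn : n = 0
  · subst hn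
    simp only [Int.cast_zero, zero_mul, add_zero, Int.cast_eq_zero] at h
    simp [h]
  · exact absurd h ((hk.intCast_mul hn).intCast_add m).ne_zero

lemma mode_eq (j : ℤ × ℤ) (p : ℝ × ℝ) :
    mode j p = Complex.exp (Complex.I * ((j.1 * p.1 + j.2 * p.2 : ℝ) : ℂ)) := by
  simp [mode]

lemma norm_mode (j : ℤ × ℤ) (p : ℝ × ℝ) : ‖mode j p‖ = 1 := by
  rw [mode_eq, Complex.norm_exp_I_mul_ofReal]

@[simp] lemma mode_zero (p : ℝ × ℝ) : mode 0 p = 1 := by simp [mode]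

lemma mode_add (j l : ℤ × ℤ) (p : ℝ × ℝ) : mode (j + l) p = mode j p * mode l p := by
  simp only [mode, ← Complex.exp_add, Prod.fst_add, Prod.snd_add]
  push_cast
  ring_nf

lemma mode_apply_add (j : ℤ × ℤ) (p q : ℝ × ℝ) : mode j (p + q) = mode j p * mode j q := by
  simp only [mode, ← Complex.exp_add, Prod.fst_add, Prod.snd_add]
  push_cast
  ring_nf

lemma mode_neg (j : ℤ × ℤ) (p : ℝ × ℝ) : mode (-j) p = (starRingEnd ℂ) (mode j p) := by
  simp only [mode, ← Complex.exp_conj]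
  simp
  ring_nf

lemma continuous_mode (j : ℤ × ℤ) : Continuous (mode j) := by
  unfold mode; fun_prop

lemma mode_line (k : ℝ) (j : ℤ × ℤ) (q : ℝ × ℝ) (t : ℝ) :
    mode j (q + t • (1, k)) = mode j q * Complex.exp (Complex.I * ((freq k j * t : ℝ) : ℂ)) := by
  rw [mode_apply_add]
  congr 1
  simp [mode, freq]
  ring_nf

lemma mode_periodic (j : ℤ × ℤ) (x y : ℝ) :
    mode j (x + 2 * Real.pi, y) = mode j (x, y) ∧ mode j (x, y + 2 * Real.pi) = mode j (x, y) := by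
  constructor
  · have h : Complex.I * ((j.1 : ℂ) * ((x + 2 * Real.pi : ℝ) : ℂ) + (j.2 : ℂ) * (y : ℂ)) =
        Complex.I * ((j.1 : ℂ) * (x : ℂ) + (j.2 : ℂ) * (y : ℂ)) +
          (j.1 : ℂ) * (2 * Real.pi * Complex.I) := by push_cast; ring
    simp only [mode]
    rw [h, Complex.exp_add, Complex.exp_int_mul_two_pi_mul_I, mul_one]
  · have h : Complex.I * ((j.1 : ℂ) * (x : ℂ) + (j.2 : ℂ) * ((y + 2 * Real.pi : ℝ) : ℂ)) =
        Complex.I * ((j.1 : ℂ) * (x : ℂ) + (j.2 : ℂ) * (y : ℂ)) +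
          (j.2 : ℂ) * (2 * Real.pi * Complex.I) := by push_cast; ring
    simp only [mode]
    rw [h, Complex.exp_add, Complex.exp_int_mul_two_pi_mul_I, mul_one]

/-! ### Absolutely convergent Fourier series on the torus. -/

/-- `u` is the sum of the absolutely convergent Fourier series with coefficients `a`. -/
structure HasFourierSeries (a : ℤ × ℤ → ℂ) (u : ℝ × ℝ → ℂ) : Prop where
  summable : Summable fun j => ‖a j‖
  hasSum : ∀ p, HasSum (fun j => a j * mode j p) (u p)

/-- `2π`-periodicity in each of the two variables, for complex-valued functions. -/
def CPeriodic (u : ℝ × ℝ → ℂ) : Prop :=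
  ∀ x y : ℝ, u (x + 2 * Real.pi, y) = u (x, y) ∧ u (x, y + 2 * Real.pi) = u (x, y)

lemma summable_norm_mul_mode {a : ℤ × ℤ → ℂ} (ha : Summable fun j => ‖a j‖) (p : ℝ × ℝ) :
    Summable fun j => a j * mode j p :=
  Summable.of_norm (by simpa [norm_mode] using ha)

lemma hasFourierSeries_tsum {a : ℤ × ℤ → ℂ} (ha : Summable fun j => ‖a j‖) :
    HasFourierSeries a fun p => ∑' j, a j * mode j p :=
  ⟨ha, fun p => (summable_norm_mul_mode ha p).hasSum⟩

namespace HasFourierSeries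

variable {a b : ℤ × ℤ → ℂ} {u v : ℝ × ℝ → ℂ}

lemma eq_tsum (h : HasFourierSeries a u) : u = fun p => ∑' j, a j * mode j p :=
  funext fun p => (h.hasSum p).tsum_eq.symm

lemma continuous (h : HasFourierSeries a u) : Continuous u := by
  rw [h.eq_tsum]
  exact continuous_tsum (fun j => continuous_const.mul (continuous_mode j)) h.summable
    (fun j p => by simp [norm_mode])

lemma continuous_real {r : ℝ × ℝ → ℝ} (h : HasFourierSeries a fun p => (r p : ℂ)) :
    Continuous r := by
  simpa only [Function.comp_def, Complex.ofReal_re] using Complex.continuous_re.comp h.continuous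

lemma periodic (h : HasFourierSeries a u) : CPeriodic u := by
  intro x y
  rw [h.eq_tsum]
  simp only [(mode_periodic _ x y).1, (mode_periodic _ x y).2, and_self]

lemma congr_coeff (h : HasFourierSeries a u) (hab : ∀ j, b j = a j) : HasFourierSeries b u := by
  rwa [show b = a from funext hab]

lemma congr_fun (h : HasFourierSeries a u) (huv : ∀ p, v p = u p) : HasFourierSeries a v := by
  rwa [show v = u from funext huv]

lemma unique (h : HasFourierSeries a u) (h' : HasFourierSeries a v) : u = v := by
  rw [h.eq_tsum, h'.eq_tsum]

lemma add (h : HasFourierSeries a u) (h' : HasFourierSeries b v) :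
    HasFourierSeries (fun j => a j + b j) (fun p => u p + v p) where
  summable := (h.summable.add h'.summable).of_nonneg_of_le (fun _ => norm_nonneg _)
    (fun _ => norm_add_le _ _)
  hasSum p := by simpa only [add_mul] using (h.hasSum p).add (h'.hasSum p)

lemma const_mul (c : ℂ) (h : HasFourierSeries a u) :
    HasFourierSeries (fun j => c * a j) (fun p => c * u p) where
  summable := by simpa only [norm_mul] using h.summable.mul_left ‖c‖
  hasSum p := by simpa only [mul_assoc] using (h.hasSum p).mul_left c

lemma mul_bounded (h : HasFourierSeries a u) {m : ℤ × ℤ → ℂ} {C : ℝ} (hm : ∀ j, ‖m j‖ ≤ C) :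
    HasFourierSeries (fun j => m j * a j) (fun p => ∑' j, (m j * a j) * mode j p) :=
  hasFourierSeries_tsum ((h.summable.mul_left C).of_nonneg_of_le (fun _ => norm_nonneg _)
    fun j => by rw [norm_mul]; exact mul_le_mul_of_nonneg_right (hm j) (norm_nonneg _))

lemma const (c : ℂ) : HasFourierSeries (fun j => if j = 0 then c else 0) (fun _ => c) where
  summable := summable_of_ne_finset_zero (s := {0}) (fun j hj => by simp_all)
  hasSum p := by
    have := hasSum_single (f := fun j : ℤ × ℤ => (if j = 0 then c else 0) * mode j p) 0
      (fun j hj => by simp [hj])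
    simpa using this

lemma add_const (h : HasFourierSeries a u) (c : ℂ) :
    HasFourierSeries (fun j => a j + if j = 0 then c else 0) (fun p => u p + c) :=
  h.add (const c)

lemma star (h : HasFourierSeries a u) :
    HasFourierSeries (fun j => (starRingEnd ℂ) (a (-j))) (fun p => (starRingEnd ℂ) (u p)) where
  summable := by
    have := (Equiv.neg (ℤ × ℤ)).summable_iff.2 h.summable
    simpa [Function.comp_def] using this
  hasSum p := by
    have := (Equiv.neg (ℤ × ℤ)).hasSum_iff.2
      ((Complex.hasSum_conj (f := fun j => (starRingEnd ℂ) (a j * mode j p))).1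
        (by simpa using h.hasSum p))
    refine this.congr_fun fun j => ?_
    simp [mode_neg]

lemma shift (h : HasFourierSeries a u) (q : ℝ × ℝ) :
    HasFourierSeries (fun j => a j * mode j q) (fun p => u (p + q)) where
  summable := by simpa [norm_mode] using h.summable
  hasSum p := by
    refine (h.hasSum (p + q)).congr_fun fun j => ?_
    rw [mode_apply_add]; ring

lemma mul_mode (h : HasFourierSeries a u) (l : ℤ × ℤ) :
    HasFourierSeries (fun j => a (j - l)) (fun p => u p * mode l p) where
  summable := (Equiv.subRight l).summable_iff.2 h.summable
  hasSum p := by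
    have := (Equiv.subRight l).hasSum_iff.2 ((h.hasSum p).mul_right (mode l p))
    refine this.congr_fun fun j => ?_
    simp only [Function.comp_apply, Equiv.subRight_apply]
    conv_lhs => rw [← sub_add_cancel j l, mode_add, ← mul_assoc]
    rw [sub_add_cancel]

end HasFourierSeries

/-! ### Mean values and recovery of the coefficients. -/

/-- The mean value over the torus of a complex-valued function. -/
def cMean (u : ℝ × ℝ → ℂ) : ℂ :=
  (1 / (2 * (Real.pi : ℂ)) ^ 2) *
    ∫ x in (0 : ℝ)..(2 * Real.pi), ∫ y in (0 : ℝ)..(2 * Real.pi), u (x, y)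

lemma ofReal_torusMean (u : ℝ × ℝ → ℝ) : (torusMean u : ℂ) = cMean fun p => (u p : ℂ) := by
  simp [torusMean, cMean, intervalIntegral.integral_ofReal]

lemma integral_exp_int (n : ℤ) :
    ∫ x in (0 : ℝ)..(2 * Real.pi), Complex.exp (Complex.I * ((n : ℂ) * (x : ℂ))) =
      if n = 0 then 2 * (Real.pi : ℂ) else 0 := by
  split_ifs with hn
  · simp [hn]
  · have h := integral_exp_mul_complex (a := 0) (b := 2 * Real.pi) (c := Complex.I * n)
      (mul_ne_zero Complex.I_ne_zero (Int.cast_ne_zero.2 hn))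
    simp only [← mul_assoc]
    rw [h]
    have : Complex.I * (n : ℂ) * ((2 * Real.pi : ℝ) : ℂ) = n * (2 * Real.pi * Complex.I) := by
      push_cast; ring
    rw [this, Complex.exp_int_mul_two_pi_mul_I]
    simp

lemma cMean_mode (j : ℤ × ℤ) : cMean (mode j) = if j = 0 then 1 else 0 := by
  have h : ∀ x y : ℝ, mode j (x, y) = Complex.exp (Complex.I * ((j.1 : ℂ) * (x : ℂ))) *
      Complex.exp (Complex.I * ((j.2 : ℂ) * (y : ℂ))) := by
    intro x y
    rw [← Complex.exp_add, mode]
    ring_nf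
  simp only [cMean, h, intervalIntegral.integral_const_mul, integral_exp_int,
    intervalIntegral.integral_mul_const]
  have hpi : (Real.pi : ℂ) ≠ 0 := by exact_mod_cast Real.pi_ne_zero
  by_cases h1 : j.1 = 0 <;> by_cases h2 : j.2 = 0 <;> simp [h1, h2, Prod.ext_iff]
  field_simp

/-- Termwise integration, by dominated convergence in each variable in turn; only the mode `0` has a
nonzero mean. -/
lemma HasFourierSeries.cMean_eq {a : ℤ × ℤ → ℂ} {u : ℝ × ℝ → ℂ} (h : HasFourierSeries a u) :
    cMean u = a 0 := by
  have h2pi : (0 : ℝ) ≤ 2 * Real.pi := by positivity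
  have hm : ∀ j (x : ℝ), Continuous fun y : ℝ => a j * mode j (x, y) := fun j x =>
    continuous_const.mul ((continuous_mode j).comp (by fun_prop))
  have h1 : ∀ x : ℝ, HasSum (fun j => ∫ y in (0 : ℝ)..(2 * Real.pi), a j * mode j (x, y))
      (∫ y in (0 : ℝ)..(2 * Real.pi), u (x, y)) := fun x =>
    intervalIntegral.hasSum_integral_of_dominated_convergence (fun j _ => ‖a j‖)
      (fun j => (hm j x).aestronglyMeasurable)
      (fun j => ae_of_all _ fun y _ => by simp [norm_mode])
      (ae_of_all _ fun y _ => h.summable) intervalIntegrable_const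
      (ae_of_all _ fun y _ => h.hasSum (x, y))
  have h2 : HasSum (fun j => ∫ x in (0 : ℝ)..(2 * Real.pi),
      ∫ y in (0 : ℝ)..(2 * Real.pi), a j * mode j (x, y))
      (∫ x in (0 : ℝ)..(2 * Real.pi), ∫ y in (0 : ℝ)..(2 * Real.pi), u (x, y)) := by
    refine intervalIntegral.hasSum_integral_of_dominated_convergence
      (fun j _ => ‖a j‖ * |2 * Real.pi - 0|) (fun j => ?_)
      (fun j => ae_of_all _ fun x _ => ?_)
      (ae_of_all _ fun y _ => h.summable.mul_right _) intervalIntegrable_const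
      (ae_of_all _ fun x _ => h1 x)
    · refine Continuous.aestronglyMeasurable ?_
      exact intervalIntegral.continuous_parametric_intervalIntegral_of_continuous'
        (f := fun x y => a j * mode j (x, y))
        (continuous_const.mul (continuous_mode j)) _ _
    · exact intervalIntegral.norm_integral_le_of_norm_le_const fun y _ => by simp [norm_mode]
  have h3 := h2.mul_left (1 / (2 * (Real.pi : ℂ)) ^ 2)
  have h4 : ∀ j, 1 / (2 * (Real.pi : ℂ)) ^ 2 * ∫ x in (0 : ℝ)..(2 * Real.pi),
      ∫ y in (0 : ℝ)..(2 * Real.pi), a j * mode j (x, y) = if j = 0 then a 0 else 0 := by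
    intro j
    simp only [intervalIntegral.integral_const_mul]
    have := cMean_mode j
    simp only [cMean] at this
    rw [mul_left_comm, this]
    split_ifs with hj <;> simp [hj]
  simp only [h4] at h3
  exact h3.unique (hasSum_ite_eq 0 (a 0))

lemma HasFourierSeries.coeff_eq {a : ℤ × ℤ → ℂ} {u : ℝ × ℝ → ℂ} (h : HasFourierSeries a u)
    (j : ℤ × ℤ) : cMean (fun p => u p * mode (-j) p) = a j := by
  simpa using (h.mul_mode (-j)).cMean_eq

lemma HasFourierSeries.torusCoeff_eq {a : ℤ × ℤ → ℂ} {u : ℝ × ℝ → ℝ}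
    (h : HasFourierSeries a fun p => (u p : ℂ)) (j : ℤ × ℤ) : torusCoeff u j = a j :=
  h.coeff_eq j

lemma HasFourierSeries.torusMean_eq {a : ℤ × ℤ → ℂ} {u : ℝ × ℝ → ℝ}
    (h : HasFourierSeries a fun p => (u p : ℂ)) : (torusMean u : ℂ) = a 0 := by
  rw [ofReal_torusMean, h.cMean_eq]

/-! ### The Hilbert transform on the torus and on the line. -/

/-- The symbol of the Hilbert transform. -/
def hilbertSymbol (k : ℝ) (j : ℤ × ℤ) : ℂ := -Complex.I * (Real.sign (freq k j) : ℂ)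

lemma norm_hilbertSymbol_le (k : ℝ) (j : ℤ × ℤ) : ‖hilbertSymbol k j‖ ≤ 1 := by
  simp only [hilbertSymbol, norm_mul, norm_neg, Complex.norm_I, one_mul, Complex.norm_real]
  rcases Real.sign_apply_eq (freq k j) with h | h | h <;> simp [h]

lemma HasFourierSeries.isTorusHilbert {k : ℝ} {a : ℤ × ℤ → ℂ} {u v : ℝ × ℝ → ℝ}
    (hu : HasFourierSeries a fun p => (u p : ℂ))
    (hv : HasFourierSeries (fun j => hilbertSymbol k j * a j) fun p => (v p : ℂ)) :
    IsTorusHilbert k u v := by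
  intro p
  simp only [hu.torusCoeff_eq]
  exact hv.hasSum p

lemma IsTorusHilbert.hasFourierSeries {k : ℝ} {a : ℤ × ℤ → ℂ} {u v : ℝ × ℝ → ℝ}
    (h : IsTorusHilbert k u v) (hu : HasFourierSeries a fun p => (u p : ℂ)) :
    HasFourierSeries (fun j => hilbertSymbol k j * a j) fun p => (v p : ℂ) where
  summable := (hu.mul_bounded (norm_hilbertSymbol_le k)).summable
  hasSum p := by
    have := h p
    simp only [hu.torusCoeff_eq] at this
    exact this

lemma mode_sub_mode_line (k : ℝ) (j : ℤ × ℤ) (p : ℝ × ℝ) (x : ℝ) :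
    mode j (p + (-x) • (1, k)) - mode j (p + x • (1, k)) =
      mode j p * (-2 * Complex.I) * ((Real.sin (freq k j * x) : ℝ) : ℂ) := by
  rw [mode_line, mode_line]
  have h1 : Complex.I * ((freq k j * -x : ℝ) : ℂ) = (-(freq k j * x : ℝ) : ℂ) * Complex.I := by
    push_cast; ring
  have h2 : Complex.I * ((freq k j * x : ℝ) : ℂ) = ((freq k j * x : ℝ) : ℂ) * Complex.I := by
    ring
  rw [h1, h2, Complex.exp_mul_I, Complex.exp_mul_I, Complex.cos_neg, Complex.sin_neg,
    Complex.ofReal_sin]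
  ring

/-- Folding about the singularity turns a mode of frequency `r` into `-2i sin(r x) / x`. On `[ε, R]`
this is bounded by `2 / ε` uniformly in the mode, so the series may be integrated term by term. -/
lemma hasSum_truncated_hilbert {k : ℝ} {a : ℤ × ℤ → ℂ} {u : ℝ × ℝ → ℂ}
    (hu : HasFourierSeries a u) (p : ℝ × ℝ) {ε R : ℝ} (hε : 0 < ε) (hR : ε ≤ R) :
    HasSum (fun j => a j * mode j p * (-2 * Complex.I) *
        ((sineIntegral (freq k j * R) - sineIntegral (freq k j * ε) : ℝ) : ℂ))
      (∫ x in ε..R, (u (p + (-x) • (1, k)) - u (p + x • (1, k))) / (x : ℂ)) := by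
  have hpos : ∀ x ∈ Set.uIoc ε R, 0 < x := fun x hx => by
    rw [Set.uIoc_of_le hR] at hx; exact hε.trans hx.1
  have hge : ∀ x ∈ Set.uIoc ε R, ε ≤ x := fun x hx => by
    rw [Set.uIoc_of_le hR] at hx; exact hx.1.le
  have key := intervalIntegral.hasSum_integral_of_dominated_convergence (μ := volume)
    (a := ε) (b := R)
    (F := fun j x => a j * mode j p * (-2 * Complex.I) *
      ((Real.sin (freq k j * x) / x : ℝ) : ℂ))
    (f := fun x => (u (p + (-x) • (1, k)) - u (p + x • (1, k))) / (x : ℂ))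
    (fun j _ => ‖a j‖ * (2 * ε⁻¹)) (fun j => ?_)
    (fun j => ae_of_all _ fun x hx => ?_)
    (ae_of_all _ fun y _ => hu.summable.mul_right _) intervalIntegrable_const
    (ae_of_all _ fun x hx => ?_)
  · refine key.congr_fun fun j => ?_
    rw [intervalIntegral.integral_const_mul, intervalIntegral.integral_ofReal,
      integral_sin_mul_div hε hR]
  · refine Measurable.aestronglyMeasurable ?_
    fun_prop
  · have h1 : |Real.sin (freq k j * x)| * x⁻¹ ≤ ε⁻¹ :=
      (mul_le_mul (Real.abs_sin_le_one _) (inv_anti₀ hε (hge x hx))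
        (inv_nonneg.2 (hpos x hx).le) zero_le_one).trans_eq (one_mul _)
    have h2 : ‖a j * mode j p * (-2 * Complex.I) *
        ((Real.sin (freq k j * x) / x : ℝ) : ℂ)‖ =
        ‖a j‖ * (2 * (|Real.sin (freq k j * x)| * x⁻¹)) := by
      rw [norm_mul, norm_mul, norm_mul, norm_mode, Complex.norm_real, Real.norm_eq_abs, abs_div,
        abs_of_pos (hpos x hx), div_eq_mul_inv]
      simp [mul_assoc]
    rw [h2]
    gcongr
  · have := ((hu.hasSum (p + (-x) • (1, k))).sub (hu.hasSum (p + x • (1, k)))).div_const (x : ℂ)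
    refine this.congr_fun fun j => ?_
    rw [← mul_sub, mode_sub_mode_line]
    push_cast
    ring

lemma truncated_hilbert_eq {U : ℝ → ℝ} (hU : Continuous U) (α : ℝ) {ε R : ℝ} (hε : 0 < ε)
    (hR : ε ≤ R) :
    (∫ s in (α - R)..(α - ε), U s / (α - s)) + ∫ s in (α + ε)..(α + R), U s / (α - s) =
      ∫ x in ε..R, (U (α - x) - U (α + x)) / x := by
  have hne : ∀ x ∈ Set.uIcc ε R, x ≠ 0 := fun x hx => by
    rw [Set.uIcc_of_le hR] at hx; exact (hε.trans_le hx.1).ne'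
  rw [← intervalIntegral.integral_comp_sub_left (fun s => U s / (α - s)),
    ← intervalIntegral.integral_comp_add_left (fun s => U s / (α - s)),
    ← intervalIntegral.integral_add]
  · refine intervalIntegral.integral_congr fun x hx => ?_
    have := hne x hx
    simp only [sub_sub_cancel, sub_add_cancel_left]
    field_simp
    ring
  · refine ContinuousOn.intervalIntegrable ?_
    simp only [sub_sub_cancel]
    exact (hU.comp (by fun_prop)).continuousOn.div continuousOn_id hne
  · refine ContinuousOn.intervalIntegrable ?_
    simp only [sub_add_cancel_left]
    exact (hU.comp (by fun_prop)).continuousOn.div (by fun_prop)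
      fun x hx => neg_ne_zero.2 (hne x hx)

/-- Each truncated mode converges to the multiplier, since `(1/π) (-2i) sgn(r) (π/2) = -i sgn(r)`.
The sine integrals are bounded independently of mode and truncation, so the limit passes through the
sum. -/
theorem HasFourierSeries.hasLineHilbert {k : ℝ} {a : ℤ × ℤ → ℂ} {u v : ℝ × ℝ → ℝ}
    (hu : HasFourierSeries a fun p => (u p : ℂ))
    (hv : HasFourierSeries (fun j => hilbertSymbol k j * a j) fun p => (v p : ℂ))
    (q : ℝ × ℝ) (α : ℝ) :
    HasLineHilbert (fun s => u (q + s • (1, k))) α (v (q + α • (1, k))) := by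
  set p := q + α • ((1, k) : ℝ × ℝ) with hp
  have hpm : ∀ x : ℝ, q + (α - x) • ((1, k) : ℝ × ℝ) = p + (-x) • (1, k) := fun x => by
    rw [hp, sub_smul, neg_smul]; abel
  have hpa : ∀ x : ℝ, q + (α + x) • ((1, k) : ℝ × ℝ) = p + x • (1, k) := fun x => by
    rw [hp, add_smul]; abel
  have hcont : Continuous u := hu.continuous_real
  have hlim : Tendsto (fun q : ℝ × ℝ => ∑' j, (1 / Real.pi : ℂ) * (a j * mode j p *
      (-2 * Complex.I) *
        ((sineIntegral (freq k j * q.2) - sineIntegral (freq k j * q.1) : ℝ) : ℂ)))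
      (𝓝[>] (0 : ℝ) ×ˢ atTop) (𝓝 (∑' j, hilbertSymbol k j * a j * mode j p)) := by
    refine tendsto_tsum_of_dominated_convergence
      (bound := fun j => ‖a j‖ * (1 / Real.pi * 2 * 8)) (hu.summable.mul_right _)
      (fun j => ?_) (Eventually.of_forall fun q j => ?_)
    · have h1 := (((Complex.continuous_ofReal.tendsto _).comp
        (tendsto_sineIntegral_sub (freq k j))).const_mul
          (a j * mode j p * (-2 * Complex.I))).const_mul (1 / Real.pi : ℂ)
      refine (h1.congr fun _ => rfl).trans_eq ?_
      congr 1
      have hpi : (Real.pi : ℂ) ≠ 0 := by exact_mod_cast Real.pi_ne_zero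
      simp only [hilbertSymbol]
      push_cast
      field_simp
    · have h8 : |sineIntegral (freq k j * q.2) - sineIntegral (freq k j * q.1)| ≤ 8 := by
        have h1 := abs_sineIntegral_le_four (freq k j * q.2)
        have h2 := abs_sineIntegral_le_four (freq k j * q.1)
        exact (abs_sub _ _).trans (by linarith)
      have : ‖(1 / Real.pi : ℂ)‖ = 1 / Real.pi := by
        rw [norm_div, norm_one, Complex.norm_real, Real.norm_of_nonneg Real.pi_pos.le]
      simp only [norm_mul, norm_mode, norm_neg, Complex.norm_I, Complex.norm_ofNat,
        Complex.norm_real, this, Real.norm_eq_abs]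
      calc _ = ‖a j‖ * (1 / Real.pi * 2 *
            |sineIntegral (freq k j * q.2) - sineIntegral (freq k j * q.1)|) := by ring
        _ ≤ _ := by gcongr
  rw [(hv.hasSum p).tsum_eq] at hlim
  have hre := (Complex.continuous_re.tendsto _).comp hlim
  simp only [Complex.ofReal_re] at hre
  refine hre.congr' ?_
  -- The folded formula needs `0 < ε ≤ R`; eventually `ε < 1 ≤ R`.
  have hev : ∀ᶠ q : ℝ × ℝ in 𝓝[>] (0 : ℝ) ×ˢ atTop, 0 < q.1 ∧ q.1 ≤ q.2 := by
    have h1 : ∀ᶠ e : ℝ in 𝓝[>] (0 : ℝ), 0 < e ∧ e < 1 :=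
      Ioo_mem_nhdsGT (show (0 : ℝ) < 1 by norm_num)
    filter_upwards [h1.prod_mk (eventually_ge_atTop (1 : ℝ))] with q hq
    exact ⟨hq.1.1, hq.1.2.le.trans hq.2⟩
  filter_upwards [hev] with e he
  have hs := (hasSum_truncated_hilbert (k := k) hu p he.1 he.2).mul_left (1 / Real.pi : ℂ)
  simp only [Function.comp_apply]
  rw [hs.tsum_eq, truncated_hilbert_eq (U := fun s => u (q + s • (1, k)))
    (hcont.comp (by fun_prop)) α he.1 he.2]
  simp only [hpm, hpa]
  have : ∀ x : ℝ, ((u (p + (-x) • (1, k)) : ℂ) - (u (p + x • (1, k)) : ℂ)) / (x : ℂ) =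
      (((u (p + (-x) • (1, k)) - u (p + x • (1, k))) / x : ℝ) : ℂ) := fun x => by push_cast; rfl
  simp only [this]
  rw [intervalIntegral.integral_ofReal, ← Complex.ofReal_one, ← Complex.ofReal_div,
    ← Complex.ofReal_mul, Complex.ofReal_re]

theorem IsTorusHilbert.hasLineHilbert {k : ℝ} {a : ℤ × ℤ → ℂ} {u v : ℝ × ℝ → ℝ}
    (h : IsTorusHilbert k u v) (hu : HasFourierSeries a fun p => (u p : ℂ)) (θ α : ℝ) :
    HasLineHilbert (fun s => u (s, θ + k * s)) α (v (α, θ + k * α)) := by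
  have := hu.hasLineHilbert (h.hasFourierSeries hu) (0, θ) α
  simpa [mul_comm k] using this

/-! ### Rapidly decaying coefficients and termwise differentiation. -/

/-- The weight `1 + |j₁| + |j₂|`. -/
def weight (j : ℤ × ℤ) : ℝ := 1 + |(j.1 : ℝ)| + |(j.2 : ℝ)|

lemma one_le_weight (j : ℤ × ℤ) : 1 ≤ weight j := by
  unfold weight; linarith [abs_nonneg (j.1 : ℝ), abs_nonneg (j.2 : ℝ)]

/-- Coefficient sequences which stay absolutely summable after multiplication by polynomials. -/
def RapidDecay (a : ℤ × ℤ → ℂ) : Prop := ∀ n : ℕ, Summable fun j => weight j ^ n * ‖a j‖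

lemma RapidDecay.summable {a : ℤ × ℤ → ℂ} (h : RapidDecay a) : Summable fun j => ‖a j‖ := by
  simpa using h 0

lemma RapidDecay.mul {a m : ℤ × ℤ → ℂ} (h : RapidDecay a) {C : ℝ}
    (hm : ∀ j, ‖m j‖ ≤ C * weight j) : RapidDecay fun j => m j * a j := by
  intro n
  refine ((h (n + 1)).mul_left C).of_nonneg_of_le (fun j => ?_) fun j => ?_
  · have := one_le_weight j
    positivity
  · have := one_le_weight j
    rw [norm_mul]
    calc weight j ^ n * (‖m j‖ * ‖a j‖) ≤ weight j ^ n * ((C * weight j) * ‖a j‖) := by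
          gcongr; exact hm j
      _ = _ := by ring

lemma RapidDecay.mul_bounded {a m : ℤ × ℤ → ℂ} (h : RapidDecay a) (hm : ∀ j, ‖m j‖ ≤ 1) :
    RapidDecay fun j => m j * a j :=
  h.mul (C := 1) fun j => (hm j).trans (by linarith [one_le_weight j])

lemma norm_I_mul_freq_le (k : ℝ) (j : ℤ × ℤ) :
    ‖Complex.I * (freq k j : ℂ)‖ ≤ (1 + |k|) * weight j := by
  rw [norm_mul, Complex.norm_I, one_mul, Complex.norm_real, Real.norm_eq_abs, freq, weight]
  refine (abs_add_le _ _).trans ?_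
  rw [abs_mul]
  nlinarith [abs_nonneg (j.1 : ℝ), abs_nonneg (j.2 : ℝ), abs_nonneg k,
    mul_nonneg (abs_nonneg k) (abs_nonneg (j.1 : ℝ))]

lemma summable_exp_neg_mul_abs {r : ℝ} (hr : 0 < r) :
    Summable fun n : ℤ => Real.exp (-(r * |(n : ℝ)|)) := by
  have h := Real.summable_exp_nat_mul_iff.2 (show -r < 0 by linarith)
  refine Summable.of_nat_of_neg ?_ ?_ <;>
  · refine h.congr fun n => ?_
    simp
    ring_nf

/-- Split the decay rate into quarters `δ = σ / 4`. As `2 max(|j₁|, |j₂|) ≥ |j₁| + |j₂|`, the decay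
is at least `e^{-2δ(|j₁| + |j₂|)}`; one half absorbs the polynomial weight through `e^{δ · weight}`,
the other remains as a summable product. -/
lemma rapidDecay_of_exp_bound {a : ℤ × ℤ → ℂ} {M σ : ℝ} (hσ : 0 < σ)
    (h : ∀ j, ‖a j‖ ≤ M * Real.exp (-σ * max |(j.1 : ℝ)| |(j.2 : ℝ)|)) : RapidDecay a := by
  intro n
  set δ := σ / 4 with hδ
  have hδ0 : 0 < δ := by positivity
  have hM : 0 ≤ M := by
    have := (norm_nonneg _).trans (h 0)
    simpa using this
  have hs : Summable fun j : ℤ × ℤ =>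
      Real.exp (-(δ * |(j.1 : ℝ)|)) * Real.exp (-(δ * |(j.2 : ℝ)|)) :=
    (summable_exp_neg_mul_abs hδ0).mul_of_nonneg (summable_exp_neg_mul_abs hδ0)
      (fun _ => (Real.exp_pos _).le) (fun _ => (Real.exp_pos _).le)
  refine (hs.mul_left (δ⁻¹ ^ n * n.factorial * Real.exp δ * M)).of_nonneg_of_le
    (fun j => ?_) fun j => ?_
  · have := one_le_weight j
    positivity
  · have hw := one_le_weight j
    have h1 : weight j ^ n ≤ δ⁻¹ ^ n * n.factorial * Real.exp (δ * weight j) := by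
      have := Real.pow_div_factorial_le_exp (δ * weight j) (by positivity) n
      rw [div_le_iff₀ (by positivity), mul_pow] at this
      calc weight j ^ n = δ⁻¹ ^ n * (δ ^ n * weight j ^ n) := by
            rw [← mul_assoc, ← mul_pow, inv_mul_cancel₀ hδ0.ne', one_pow, one_mul]
        _ ≤ δ⁻¹ ^ n * (Real.exp (δ * weight j) * n.factorial) := by gcongr
        _ = _ := by ring
    have h2 : |(j.1 : ℝ)| + |(j.2 : ℝ)| ≤ 2 * max |(j.1 : ℝ)| |(j.2 : ℝ)| := by
      linarith [le_max_left |(j.1 : ℝ)| |(j.2 : ℝ)|, le_max_right |(j.1 : ℝ)| |(j.2 : ℝ)|]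
    have h3 : Real.exp (δ * weight j) * Real.exp (-σ * max |(j.1 : ℝ)| |(j.2 : ℝ)|) ≤
        Real.exp δ * (Real.exp (-(δ * |(j.1 : ℝ)|)) * Real.exp (-(δ * |(j.2 : ℝ)|))) := by
      rw [← Real.exp_add, ← Real.exp_add, ← Real.exp_add]
      refine Real.exp_le_exp.2 ?_
      rw [weight, show σ = 4 * δ by rw [hδ]; ring]
      nlinarith
    calc weight j ^ n * ‖a j‖ ≤ (δ⁻¹ ^ n * n.factorial * Real.exp (δ * weight j)) *
          (M * Real.exp (-σ * max |(j.1 : ℝ)| |(j.2 : ℝ)|)) := by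
            gcongr; exact h j
      _ = (δ⁻¹ ^ n * n.factorial * M) *
          (Real.exp (δ * weight j) * Real.exp (-σ * max |(j.1 : ℝ)| |(j.2 : ℝ)|)) := by ring
      _ ≤ (δ⁻¹ ^ n * n.factorial * M) *
          (Real.exp δ * (Real.exp (-(δ * |(j.1 : ℝ)|)) * Real.exp (-(δ * |(j.2 : ℝ)|)))) := by
            gcongr
      _ = _ := by ring

/-- The first coordinate functional on `ℝ × ℝ`, with complex values. -/
def coordFst : ℝ × ℝ →L[ℝ] ℂ := Complex.ofRealCLM.comp (ContinuousLinearMap.fst ℝ ℝ ℝ)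

/-- The second coordinate functional on `ℝ × ℝ`, with complex values. -/
def coordSnd : ℝ × ℝ →L[ℝ] ℂ := Complex.ofRealCLM.comp (ContinuousLinearMap.snd ℝ ℝ ℝ)

@[simp] lemma coordFst_apply (p : ℝ × ℝ) : coordFst p = (p.1 : ℂ) := rfl

@[simp] lemma coordSnd_apply (p : ℝ × ℝ) : coordSnd p = (p.2 : ℂ) := rfl

lemma hasFDerivAt_mode (j : ℤ × ℤ) (p : ℝ × ℝ) : HasFDerivAt (mode j)
    ((Complex.I * j.1 * mode j p) • coordFst + (Complex.I * j.2 * mode j p) • coordSnd) p := by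
  have h1 : HasFDerivAt (fun q : ℝ × ℝ => Complex.I * ((j.1 : ℂ) * coordFst q +
      (j.2 : ℂ) * coordSnd q)) (Complex.I • ((j.1 : ℂ) • coordFst + (j.2 : ℂ) • coordSnd)) p :=
    ((coordFst.hasFDerivAt.const_mul _).add (coordSnd.hasFDerivAt.const_mul _)).const_mul _
  refine h1.cexp.congr_fderiv ?_
  ext <;> simp [mode] <;> ring

lemma HasFourierSeries.hasFDerivAt {a : ℤ × ℤ → ℂ} {u u₁ u₂ : ℝ × ℝ → ℂ}
    (ha : RapidDecay a) (hu : HasFourierSeries a u)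
    (h₁ : HasFourierSeries (fun j => Complex.I * j.1 * a j) u₁)
    (h₂ : HasFourierSeries (fun j => Complex.I * j.2 * a j) u₂) (p : ℝ × ℝ) :
    HasFDerivAt u (u₁ p • coordFst + u₂ p • coordSnd) p := by
  have hsum : ∀ q, HasSum (fun j => a j • ((Complex.I * j.1 * mode j q) • coordFst +
      (Complex.I * j.2 * mode j q) • coordSnd)) (u₁ q • coordFst + u₂ q • coordSnd) := by
    intro q
    refine (((h₁.hasSum q).smul_const coordFst).add ((h₂.hasSum q).smul_const coordSnd)).congr_fun
      fun j => ?_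
    ext <;> simp <;> ring
  have hnorm : ∀ j q, ‖a j • ((Complex.I * j.1 * mode j q) • coordFst +
      (Complex.I * j.2 * mode j q) • coordSnd)‖ ≤ weight j ^ 1 * ‖a j‖ := by
    intro j q
    rw [norm_smul, pow_one, mul_comm]
    gcongr
    have hc1 : ‖coordFst‖ ≤ 1 := coordFst.opNorm_le_bound zero_le_one fun x => by
      simpa using norm_fst_le x
    have hc2 : ‖coordSnd‖ ≤ 1 := coordSnd.opNorm_le_bound zero_le_one fun x => by
      simpa using norm_snd_le x
    refine (norm_add_le _ _).trans ?_
    simp only [norm_smul, norm_mul, Complex.norm_I, one_mul, norm_mode, mul_one,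
      Complex.norm_intCast]
    unfold weight
    nlinarith [abs_nonneg (j.1 : ℝ), abs_nonneg (j.2 : ℝ),
      mul_le_of_le_one_right (abs_nonneg (j.1 : ℝ)) hc1,
      mul_le_of_le_one_right (abs_nonneg (j.2 : ℝ)) hc2]
  have key := hasFDerivAt_tsum (ha 1)
    (fun j q => (hasFDerivAt_mode j q).const_smul (a j)) hnorm
    (x₀ := 0) (by simpa using (hu.hasSum 0).summable) p
  rw [(hsum p).tsum_eq] at key
  rw [hu.eq_tsum]
  exact key

lemma RapidDecay.mul_fst {a : ℤ × ℤ → ℂ} (ha : RapidDecay a) :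
    RapidDecay fun j => Complex.I * j.1 * a j :=
  ha.mul (C := 1) fun j => by
    simp only [norm_mul, Complex.norm_I, one_mul, Complex.norm_intCast, weight]
    linarith [abs_nonneg (j.1 : ℝ), abs_nonneg (j.2 : ℝ)]

lemma RapidDecay.mul_snd {a : ℤ × ℤ → ℂ} (ha : RapidDecay a) :
    RapidDecay fun j => Complex.I * j.2 * a j :=
  ha.mul (C := 1) fun j => by
    simp only [norm_mul, Complex.norm_I, one_mul, Complex.norm_intCast, weight]
    linarith [abs_nonneg (j.1 : ℝ), abs_nonneg (j.2 : ℝ)]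

/-- Induction over all series at once: both partial derivatives are again sums of series with
rapidly decaying coefficients. -/
lemma HasFourierSeries.contDiff_nat (n : ℕ) : ∀ {a : ℤ × ℤ → ℂ} {u : ℝ × ℝ → ℂ},
    RapidDecay a → HasFourierSeries a u → ContDiff ℝ n u := by
  induction n with
  | zero => exact fun _ hu => contDiff_zero.2 hu.continuous
  | succ n ih =>
    intro a u ha hu
    have h₁ := hasFourierSeries_tsum ha.mul_fst.summable
    have h₂ := hasFourierSeries_tsum ha.mul_snd.summable
    push_cast
    refine contDiff_succ_iff_hasFDerivAt.2 ⟨_, ?_, hu.hasFDerivAt ha h₁ h₂⟩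
    exact ((ih ha.mul_fst h₁).smul contDiff_const).add ((ih ha.mul_snd h₂).smul contDiff_const)

lemma HasFourierSeries.hasDerivAt_line {k : ℝ} {a : ℤ × ℤ → ℂ} {u v : ℝ × ℝ → ℂ}
    (ha : RapidDecay a) (hu : HasFourierSeries a u)
    (hv : HasFourierSeries (fun j => Complex.I * freq k j * a j) v) (p : ℝ × ℝ) (t : ℝ) :
    HasDerivAt (fun s : ℝ => u (p + s • (1, k))) (v (p + t • (1, k))) t := by
  have h₁ := hasFourierSeries_tsum ha.mul_fst.summable
  have h₂ := hasFourierSeries_tsum ha.mul_snd.summable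
  have hf := hu.hasFDerivAt ha h₁ h₂ (p + t • (1, k))
  have hl : HasDerivAt (fun s : ℝ => p + s • ((1, k) : ℝ × ℝ)) (1, k) t := by
    simpa using ((hasDerivAt_id t).smul_const ((1, k) : ℝ × ℝ)).const_add p
  refine (hf.comp_hasDerivAt t hl).congr_deriv ?_
  have h12 := hv.unique ((h₁.add (h₂.const_mul k)).congr_coeff fun j => by
    simp only [freq]; push_cast; ring)
  rw [h12]
  simp
  ring

lemma torusDeriv_eq_deriv (u : ℝ × ℝ → ℝ) (k : ℝ) (p : ℝ × ℝ) :
    torusDeriv k u p = deriv (fun s : ℝ => u (p + s • (1, k))) 0 := rfl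

/-- The coefficients of the `α`-derivative. -/
lemma HasFourierSeries.torusDeriv {k : ℝ} {a : ℤ × ℤ → ℂ} {u : ℝ × ℝ → ℝ}
    (ha : RapidDecay a) (hu : HasFourierSeries a fun p => (u p : ℂ)) :
    HasFourierSeries (fun j => Complex.I * freq k j * a j)
      fun p => (QPWave.torusDeriv k u p : ℂ) := by
  have hv := hasFourierSeries_tsum (ha.mul (norm_I_mul_freq_le k)).summable
  refine hv.congr_fun fun p => ?_
  have h0 := hu.hasDerivAt_line ha hv p 0
  rw [zero_smul, add_zero] at h0
  have hre := Complex.reCLM.hasFDerivAt.comp_hasDerivAt (0 : ℝ) h0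
  simp only [Function.comp_def, Complex.reCLM_apply, Complex.ofReal_re] at hre
  have h1 := hre.ofReal_comp
  rw [torusDeriv_eq_deriv, hre.deriv]
  exact h1.unique h0

lemma RapidDecay.mul_freq {k : ℝ} {a : ℤ × ℤ → ℂ} (ha : RapidDecay a) :
    RapidDecay fun j => Complex.I * freq k j * a j :=
  ha.mul (norm_I_mul_freq_le k)

lemma HasFourierSeries.hasDerivAt_torusDeriv {k : ℝ} {a : ℤ × ℤ → ℂ} {u : ℝ × ℝ → ℝ}
    (ha : RapidDecay a) (hu : HasFourierSeries a fun p => (u p : ℂ)) (p : ℝ × ℝ) (t : ℝ) :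
    HasDerivAt (fun s : ℝ => u (p + s • (1, k))) (QPWave.torusDeriv k u (p + t • (1, k))) t := by
  have h0 := hu.hasDerivAt_line ha (hu.torusDeriv (k := k) ha) p t
  have hre := Complex.reCLM.hasFDerivAt.comp_hasDerivAt t h0
  simpa only [Function.comp_def, Complex.reCLM_apply, Complex.ofReal_re] using hre

/-- No differentiability is required: both sides are the same one-variable `deriv` up to a
translation of the parameter, including where it takes its default value. -/
lemma deriv_line (k : ℝ) (u : ℝ × ℝ → ℝ) (θ α : ℝ) :
    deriv (fun s => u (s, θ + k * s)) α = torusDeriv k u (α, θ + k * α) := by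
  rw [torusDeriv_eq_deriv]
  have := deriv_comp_const_add (f := fun s => u (s, θ + k * s)) α 0
  rw [add_zero] at this
  rw [← this]
  congr 1
  funext s
  simp only [Prod.smul_mk, smul_eq_mul, mul_one, Prod.mk_add_mk]
  congr 2
  ring

lemma torusDeriv_add_const (k : ℝ) (u : ℝ × ℝ → ℝ) (c : ℝ) (p : ℝ × ℝ) :
    torusDeriv k (fun q => u q + c) p = torusDeriv k u p := by
  rw [torusDeriv_eq_deriv, torusDeriv_eq_deriv, deriv_add_const]

lemma torusDeriv_const_mul (k : ℝ) (u : ℝ × ℝ → ℝ) (c : ℝ) (p : ℝ × ℝ) :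
    torusDeriv k (fun q => c * u q) p = c * torusDeriv k u p := by
  rw [torusDeriv_eq_deriv, torusDeriv_eq_deriv, deriv_const_mul_field]

lemma torusDeriv_shift (k : ℝ) (u : ℝ × ℝ → ℝ) (q p : ℝ × ℝ) :
    torusDeriv k (fun r => u (r + q)) p = torusDeriv k u (p + q) := by
  rw [torusDeriv_eq_deriv, torusDeriv_eq_deriv]
  simp only [add_right_comm]

/-! ### Closure properties of real analytic functions on the torus. -/

lemma TorusAnalytic.exists_hasFourierSeries {u : ℝ × ℝ → ℝ} (h : TorusAnalytic u) :
    ∃ a, RapidDecay a ∧ HasFourierSeries a fun p => (u p : ℂ) := by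
  obtain ⟨a, M, σ, hσ, -, hb, hs⟩ := h
  have ha := rapidDecay_of_exp_bound hσ hb
  exact ⟨a, ha, ha.summable, hs⟩

lemma TorusAnalytic.const (c : ℝ) : TorusAnalytic fun _ => c := by
  refine ⟨fun j => if j = 0 then (c : ℂ) else 0, |c|, 1, one_pos, fun j => ?_, fun j => ?_,
    (HasFourierSeries.const (c : ℂ)).hasSum⟩
  · by_cases h : j = 0 <;> simp [h]
  · by_cases h : j = 0
    · simp [h]
    · simp only [h, if_false, norm_zero]; positivity

lemma TorusAnalytic.const_mul {u : ℝ × ℝ → ℝ} (h : TorusAnalytic u) (c : ℝ) :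
    TorusAnalytic fun p => c * u p := by
  obtain ⟨a, M, σ, hσ, hr, hb, hs⟩ := h
  refine ⟨fun j => c * a j, |c| * M, σ, hσ, fun j => ?_, fun j => ?_, fun p => ?_⟩
  · simp [hr]
  · rw [norm_mul, Complex.norm_real, Real.norm_eq_abs, mul_assoc]
    gcongr
    exact hb j
  · push_cast
    simpa only [mul_assoc] using (hs p).mul_left (c : ℂ)

lemma TorusAnalytic.add {u v : ℝ × ℝ → ℝ} (hu : TorusAnalytic u) (hv : TorusAnalytic v) :
    TorusAnalytic fun p => u p + v p := by
  obtain ⟨a, M, σ, hσ, hr, hb, hs⟩ := hu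
  obtain ⟨a', M', σ', hσ', hr', hb', hs'⟩ := hv
  have hM : 0 ≤ M := by simpa using (norm_nonneg _).trans (hb 0)
  have hM' : 0 ≤ M' := by simpa using (norm_nonneg _).trans (hb' 0)
  refine ⟨fun j => a j + a' j, M + M', min σ σ', lt_min hσ hσ', fun j => ?_, fun j => ?_,
    fun p => ?_⟩
  · simp [hr, hr']
  · have hm : 0 ≤ max |(j.1 : ℝ)| |(j.2 : ℝ)| := le_max_of_le_left (abs_nonneg _)
    refine (norm_add_le _ _).trans ?_
    rw [add_mul]
    refine add_le_add ((hb j).trans ?_) ((hb' j).trans ?_)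
    · gcongr; exact min_le_left _ _
    · gcongr; exact min_le_right _ _
  · push_cast
    simpa only [add_mul] using (hs p).add (hs' p)

lemma TorusAnalytic.shift {u : ℝ × ℝ → ℝ} (h : TorusAnalytic u) (q : ℝ × ℝ) :
    TorusAnalytic fun p => u (p + q) := by
  obtain ⟨a, M, σ, hσ, hr, hb, hs⟩ := h
  refine ⟨fun j => a j * mode j q, M, σ, hσ, fun j => ?_, fun j => ?_, fun p => ?_⟩
  · simp only [hr, mode_neg, map_mul]
  · rw [norm_mul, norm_mode, mul_one]; exact hb j
  · refine (hs (p + q)).congr_fun fun j => ?_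
    rw [mode_apply_add]; ring

lemma TorusAnalytic.hilbert {k : ℝ} {u v : ℝ × ℝ → ℝ} (h : TorusAnalytic u)
    (hv : IsTorusHilbert k u v) : TorusAnalytic v := by
  obtain ⟨a, M, σ, hσ, hr, hb, hs⟩ := h
  have hu : HasFourierSeries a fun p => (u p : ℂ) := ⟨(rapidDecay_of_exp_bound hσ hb).summable, hs⟩
  refine ⟨fun j => hilbertSymbol k j * a j, M, σ, hσ, fun j => ?_, fun j => ?_,
    (hv.hasFourierSeries hu).hasSum⟩
  · simp [hr, hilbertSymbol, freq_neg, Real.sign_neg]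
  · rw [norm_mul]
    exact (mul_le_of_le_one_left (norm_nonneg _) (norm_hilbertSymbol_le k j)).trans (hb j)

/-! ### Periodic functions: bounds, positivity of the mean square, and coefficients of smooth
functions. -/

/-- The representative in `[0, 2π)²` of a point modulo `2πℤ²`. -/
def torusRep (p : ℝ × ℝ) : ℝ × ℝ :=
  (toIcoMod Real.two_pi_pos 0 p.1, toIcoMod Real.two_pi_pos 0 p.2)

lemma torusRep_mem (p : ℝ × ℝ) :
    torusRep p ∈ Set.Icc (0 : ℝ) (2 * Real.pi) ×ˢ Set.Icc (0 : ℝ) (2 * Real.pi) := by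
  have h1 := toIcoMod_mem_Ico' Real.two_pi_pos p.1
  have h2 := toIcoMod_mem_Ico' Real.two_pi_pos p.2
  exact ⟨⟨h1.1, h1.2.le⟩, ⟨h2.1, h2.2.le⟩⟩

lemma CPeriodic.apply_torusRep {u : ℝ × ℝ → ℂ} (hu : CPeriodic u) (p : ℝ × ℝ) :
    u (torusRep p) = u p := by
  have h1 : ∀ y, Function.Periodic (fun x => u (x, y)) (2 * Real.pi) := fun y x => (hu x y).1
  have h2 : ∀ x, Function.Periodic (fun y => u (x, y)) (2 * Real.pi) := fun x y => (hu x y).2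
  have e1 := (h1 (toIcoMod Real.two_pi_pos 0 p.2)).sub_zsmul_eq
    (x := p.1) (toIcoDiv Real.two_pi_pos 0 p.1)
  have e2 := (h2 p.1).sub_zsmul_eq (x := p.2) (toIcoDiv Real.two_pi_pos 0 p.2)
  exact e1.trans e2

lemma CPeriodic.exists_bound {u : ℝ × ℝ → ℂ} (hu : CPeriodic u) (hc : Continuous u) :
    ∃ C, ∀ p, ‖u p‖ ≤ C := by
  obtain ⟨C, hC⟩ := (isCompact_Icc.prod isCompact_Icc :
    IsCompact (Set.Icc (0 : ℝ) (2 * Real.pi) ×ˢ Set.Icc (0 : ℝ) (2 * Real.pi))).exists_bound_of_continuousOn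
      hc.continuousOn
  exact ⟨C, fun p => by rw [← hu.apply_torusRep]; exact hC _ (torusRep_mem p)⟩

lemma continuous_inner_integral {u : ℝ × ℝ → ℂ} (hu : Continuous u) :
    Continuous fun x : ℝ => ∫ y in (0 : ℝ)..(2 * Real.pi), u (x, y) :=
  intervalIntegral.continuous_parametric_intervalIntegral_of_continuous'
    (f := fun x y => u (x, y)) hu _ _

lemma cMean_add {u v : ℝ × ℝ → ℂ} (hu : Continuous u) (hv : Continuous v) :
    cMean (fun p => u p + v p) = cMean u + cMean v := by
  unfold cMean
  rw [← mul_add, ← intervalIntegral.integral_add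
    ((continuous_inner_integral hu).intervalIntegrable _ _)
    ((continuous_inner_integral hv).intervalIntegrable _ _)]
  congr 2
  funext x
  exact intervalIntegral.integral_add
    ((hu.comp (by fun_prop : Continuous fun y : ℝ => (x, y))).intervalIntegrable _ _)
    ((hv.comp (by fun_prop : Continuous fun y : ℝ => (x, y))).intervalIntegrable _ _)

lemma cMean_const_mul (c : ℂ) (u : ℝ × ℝ → ℂ) : cMean (fun p => c * u p) = c * cMean u := by
  simp only [cMean, intervalIntegral.integral_const_mul]
  ring

lemma cMean_conj {u : ℝ × ℝ → ℂ} :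
    cMean (fun p => (starRingEnd ℂ) (u p)) = (starRingEnd ℂ) (cMean u) := by
  have h2 : (0 : ℝ) ≤ 2 * Real.pi := by positivity
  simp only [cMean, intervalIntegral.integral_of_le h2, integral_conj, map_mul, map_div₀, map_pow,
    Complex.conj_ofReal, map_one, map_ofNat]

lemma norm_cMean_le {u : ℝ × ℝ → ℂ} {C : ℝ} (hC : ∀ p, ‖u p‖ ≤ C) : ‖cMean u‖ ≤ C := by
  have h2 : (0 : ℝ) < 2 * Real.pi := by positivity
  have h := intervalIntegral.norm_integral_le_of_norm_le_const (a := 0) (b := 2 * Real.pi)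
    (f := fun x => ∫ y in (0 : ℝ)..(2 * Real.pi), u (x, y)) fun x _ =>
      intervalIntegral.norm_integral_le_of_norm_le_const (a := 0) (b := 2 * Real.pi)
        (f := fun y => u (x, y)) fun y _ => hC (x, y)
  rw [sub_zero, abs_of_pos h2] at h
  have h3 : ‖(1 / (2 * (Real.pi : ℂ)) ^ 2)‖ = 1 / (2 * Real.pi) ^ 2 := by
    rw [norm_div, norm_pow, norm_mul, Complex.norm_real, Real.norm_of_nonneg Real.pi_pos.le]
    simp
  unfold cMean
  rw [norm_mul, h3, div_mul_eq_mul_div, one_mul, div_le_iff₀ (by positivity)]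
  calc _ ≤ _ := h
    _ = _ := by ring

/-- A continuous nonnegative function that is positive somewhere in the period square has positive
integral: first the inner integral through that point, then the outer one. -/
lemma eq_zero_of_cMean_norm_sq {u : ℝ × ℝ → ℂ} (hc : Continuous u) (hp : CPeriodic u)
    (h : cMean (fun p => (starRingEnd ℂ) (u p) * u p) = 0) (p : ℝ × ℝ) : u p = 0 := by
  have h2 : (0 : ℝ) < 2 * Real.pi := by positivity
  set g : ℝ × ℝ → ℝ := fun p => Complex.normSq (u p) with hg
  have hgc : Continuous g := Complex.continuous_normSq.comp hc
  have hgi : Continuous fun x : ℝ => ∫ y in (0 : ℝ)..(2 * Real.pi), g (x, y) :=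
    intervalIntegral.continuous_parametric_intervalIntegral_of_continuous'
      (f := fun x y => g (x, y)) hgc _ _
  have hm : torusMean g = 0 := by
    have : (torusMean g : ℂ) = 0 := by
      rw [ofReal_torusMean, ← h]
      congr 1
      funext p
      rw [hg, Complex.normSq_eq_conj_mul_self]
    exact_mod_cast this
  by_contra hne
  rw [← hp.apply_torusRep] at hne
  obtain ⟨hx, hy⟩ := torusRep_mem p
  have hpos1 : 0 < ∫ y in (0 : ℝ)..(2 * Real.pi), g ((torusRep p).1, y) :=
    intervalIntegral.integral_pos h2 (hgc.comp (by fun_prop)).continuousOn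
      (fun y _ => Complex.normSq_nonneg _) ⟨_, hy, Complex.normSq_pos.2 hne⟩
  have hpos2 : 0 < ∫ x in (0 : ℝ)..(2 * Real.pi), ∫ y in (0 : ℝ)..(2 * Real.pi), g (x, y) :=
    intervalIntegral.integral_pos h2 hgi.continuousOn
      (fun x _ => intervalIntegral.integral_nonneg h2.le fun y _ => Complex.normSq_nonneg _)
      ⟨_, hx, hpos1⟩
  have : 0 < torusMean g := by unfold torusMean; positivity
  exact this.ne' hm

lemma contDiff_fderiv_apply {u : ℝ × ℝ → ℂ} (hu : ContDiff ℝ ∞ u) (v : ℝ × ℝ) :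
    ContDiff ℝ ∞ fun p => fderiv ℝ u p v :=
  (hu.fderiv_right (m := ∞) (by simp)).clm_apply contDiff_const

lemma CPeriodic.fderiv_apply {u : ℝ × ℝ → ℂ} (hu : CPeriodic u) (v : ℝ × ℝ) :
    CPeriodic fun p => fderiv ℝ u p v := by
  have h1 : (fun p : ℝ × ℝ => u (p + (2 * Real.pi, 0))) = u := by
    funext ⟨x, y⟩
    simpa using (hu x y).1
  have h2 : (fun p : ℝ × ℝ => u (p + (0, 2 * Real.pi))) = u := by
    funext ⟨x, y⟩
    simpa using (hu x y).2
  intro x y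
  constructor
  · have := fderiv_comp_add_right (𝕜 := ℝ) (f := u) (x := (x, y)) (2 * Real.pi, 0)
    rw [h1] at this
    simp [this]
  · have := fderiv_comp_add_right (𝕜 := ℝ) (f := u) (x := (x, y)) (0, 2 * Real.pi)
    rw [h2] at this
    simp [this]

lemma cMean_fderiv_fst {u : ℝ × ℝ → ℂ} (hu : ContDiff ℝ ∞ u) (hp : CPeriodic u) :
    cMean (fun p => fderiv ℝ u p (1, 0)) = 0 := by
  have hc : Continuous (fun p => fderiv ℝ u p (1, 0)) := (contDiff_fderiv_apply hu (1, 0)).continuous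
  unfold cMean
  -- The derivative is in the first variable, so that variable has to be integrated innermost.
  rw [MeasureTheory.intervalIntegral_intervalIntegral_swap]
  · have : ∀ y : ℝ, ∫ x in (0 : ℝ)..(2 * Real.pi), fderiv ℝ u (x, y) (1, 0) = 0 := by
      intro y
      have hd : ∀ x : ℝ, HasDerivAt (fun x => u (x, y)) (fderiv ℝ u (x, y) (1, 0)) x := fun x => by
        have h1 := (hu.differentiable (by simp) (x, y)).hasFDerivAt
        exact h1.comp_hasDerivAt x ((hasDerivAt_id x).prodMk (hasDerivAt_const x y))
      rw [intervalIntegral.integral_eq_sub_of_hasDerivAt (fun x _ => hd x)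
        ((hc.comp (by fun_prop : Continuous fun x : ℝ => (x, y))).intervalIntegrable _ _)]
      have := (hp 0 y).1
      rw [zero_add] at this
      rw [this, sub_self]
    simp [this]
  · exact (hc.continuousOn.integrableOn_compact (isCompact_uIcc.prod isCompact_uIcc)).mono_set
      (Set.prod_mono Set.uIoc_subset_uIcc Set.uIoc_subset_uIcc)

lemma cMean_fderiv_snd {u : ℝ × ℝ → ℂ} (hu : ContDiff ℝ ∞ u) (hp : CPeriodic u) :
    cMean (fun p => fderiv ℝ u p (0, 1)) = 0 := by
  have hc : Continuous (fun p => fderiv ℝ u p (0, 1)) := (contDiff_fderiv_apply hu (0, 1)).continuous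
  have : ∀ x : ℝ, ∫ y in (0 : ℝ)..(2 * Real.pi), fderiv ℝ u (x, y) (0, 1) = 0 := by
    intro x
    have hd : ∀ y : ℝ, HasDerivAt (fun y => u (x, y)) (fderiv ℝ u (x, y) (0, 1)) y := fun y => by
      have h1 := (hu.differentiable (by simp) (x, y)).hasFDerivAt
      exact h1.comp_hasDerivAt y ((hasDerivAt_const y x).prodMk (hasDerivAt_id y))
    rw [intervalIntegral.integral_eq_sub_of_hasDerivAt (fun x _ => hd x)
      ((hc.comp (by fun_prop : Continuous fun y : ℝ => (x, y))).intervalIntegrable _ _)]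
    have := (hp x 0).2
    rw [zero_add] at this
    rw [this, sub_self]
  simp [cMean, this]

lemma contDiff_mode (j : ℤ × ℤ) : ContDiff ℝ ∞ (mode j) := by
  have h1 : ContDiff ℝ ∞ fun q : ℝ × ℝ => Complex.I * ((j.1 : ℂ) * coordFst q +
      (j.2 : ℂ) * coordSnd q) :=
    contDiff_const.mul ((contDiff_const.mul coordFst.contDiff).add
      (contDiff_const.mul coordSnd.contDiff))
  exact h1.cexp

/-- The Fourier coefficients of a complex-valued function. -/
def cCoeff (u : ℝ × ℝ → ℂ) (j : ℤ × ℤ) : ℂ := cMean fun p => u p * mode (-j) p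

lemma fderiv_mul_mode {u : ℝ × ℝ → ℂ} (hu : ContDiff ℝ ∞ u) (j : ℤ × ℤ) (p v : ℝ × ℝ) :
    fderiv ℝ (fun q => u q * mode (-j) q) p v = fderiv ℝ u p v * mode (-j) p +
      -(Complex.I * (j.1 * v.1 + j.2 * v.2)) * (u p * mode (-j) p) := by
  have h1 := (hu.differentiable (by simp) p).hasFDerivAt
  have h2 : HasFDerivAt (fun q => u q * mode (-j) q) _ p := h1.mul (hasFDerivAt_mode (-j) p)
  rw [h2.fderiv]
  simp
  ring

lemma CPeriodic.mul_mode {u : ℝ × ℝ → ℂ} (hu : CPeriodic u) (j : ℤ × ℤ) :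
    CPeriodic fun p => u p * mode j p := fun x y => by
  simp only [(mode_periodic j x y).1, (mode_periodic j x y).2, (hu x y).1, (hu x y).2, and_self]

lemma cCoeff_add {u v : ℝ × ℝ → ℂ} (hu : Continuous u) (hv : Continuous v) (j : ℤ × ℤ) :
    cCoeff (fun p => u p + v p) j = cCoeff u j + cCoeff v j := by
  simp only [cCoeff, add_mul]
  exact cMean_add (hu.mul (continuous_mode _)) (hv.mul (continuous_mode _))

lemma cCoeff_const_mul (c : ℂ) (u : ℝ × ℝ → ℂ) (j : ℤ × ℤ) :
    cCoeff (fun p => c * u p) j = c * cCoeff u j := by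
  simp only [cCoeff, mul_assoc, cMean_const_mul]

/-- Integration by parts. The vanishing of means of `v`-derivatives is a hypothesis, so that both
coordinate directions are covered by one argument. -/
lemma cCoeff_fderiv {v : ℝ × ℝ}
    (hv : ∀ w, ContDiff ℝ ∞ w → CPeriodic w → cMean (fun p => fderiv ℝ w p v) = 0)
    {u : ℝ × ℝ → ℂ} (hu : ContDiff ℝ ∞ u) (hp : CPeriodic u) (j : ℤ × ℤ) :
    cCoeff (fun p => fderiv ℝ u p v) j = Complex.I * (j.1 * v.1 + j.2 * v.2) * cCoeff u j := by
  have h0 := hv _ (hu.mul (contDiff_mode (-j))) (hp.mul_mode (-j))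
  simp only [fderiv_mul_mode hu] at h0
  rw [cMean_add (u := fun p => fderiv ℝ u p v * mode (-j) p)
    (v := fun p => -(Complex.I * (j.1 * v.1 + j.2 * v.2)) * (u p * mode (-j) p))
    ((contDiff_fderiv_apply hu v).continuous.mul (continuous_mode _))
    (continuous_const.mul (hu.continuous.mul (continuous_mode _))), cMean_const_mul] at h0
  unfold cCoeff
  linear_combination h0

/-- The witness is `u - ∂_v² u`; the factor `-(i j·v)²` is `(j·v)²`. -/
lemma exists_cCoeff_eq_one_add_sq_mul {v : ℝ × ℝ}
    (hv : ∀ w, ContDiff ℝ ∞ w → CPeriodic w → cMean (fun p => fderiv ℝ w p v) = 0)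
    {u : ℝ × ℝ → ℂ} (hu : ContDiff ℝ ∞ u) (hp : CPeriodic u) :
    ∃ w, ContDiff ℝ ∞ w ∧ CPeriodic w ∧
      ∀ j, cCoeff w j = (1 + ((j.1 : ℂ) * v.1 + j.2 * v.2) ^ 2) * cCoeff u j := by
  have h1 := contDiff_fderiv_apply hu v
  have h1p := hp.fderiv_apply v
  have h2 := contDiff_fderiv_apply h1 v
  have h2p := h1p.fderiv_apply v
  refine ⟨fun p => u p + (-1) * fderiv ℝ (fun q => fderiv ℝ u q v) p v,
    hu.add (contDiff_const.mul h2), fun x y => ?_, fun j => ?_⟩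
  · have h := h2p x y
    simp only at h
    simp only [(hp x y).1, (hp x y).2, h.1, h.2, and_self]
  · rw [cCoeff_add (v := fun p => (-1) * fderiv ℝ (fun q => fderiv ℝ u q v) p v)
      hu.continuous (continuous_const.mul h2.continuous), cCoeff_const_mul,
      cCoeff_fderiv hv h1 h1p, cCoeff_fderiv hv hu hp]
    linear_combination (-((j.1 : ℂ) * v.1 + j.2 * v.2) ^ 2 * cCoeff u j) * Complex.I_sq

lemma summable_int_inv_one_add_sq : Summable fun n : ℤ => (1 + (n : ℝ) ^ 2)⁻¹ := by
  have h : Summable fun n : ℕ => (1 + (n : ℝ) ^ 2)⁻¹ := by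
    refine (summable_nat_add_iff 1).1 ?_
    have h1 := (summable_nat_add_iff 1).2 (Real.summable_one_div_nat_pow.2 one_lt_two)
    refine h1.of_nonneg_of_le (fun n => by positivity) fun n => ?_
    rw [one_div]
    exact inv_anti₀ (by positivity) (by linarith)
  refine Summable.of_nat_of_neg ?_ ?_ <;> simpa using h

/-- Applying `1 - ∂₁²` and `1 - ∂₂²` gives a smooth periodic, hence bounded, function. Its
coefficients are bounded, so those of `u` are `O((1 + j₁²)⁻¹ (1 + j₂²)⁻¹)`. -/
theorem summable_cCoeff {u : ℝ × ℝ → ℂ} (hu : ContDiff ℝ ∞ u) (hp : CPeriodic u) :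
    Summable fun j => ‖cCoeff u j‖ := by
  obtain ⟨v, hv, hvp, hvc⟩ := exists_cCoeff_eq_one_add_sq_mul
    (fun _ => cMean_fderiv_fst) hu hp
  obtain ⟨w, hw, hwp, hwc⟩ := exists_cCoeff_eq_one_add_sq_mul
    (fun _ => cMean_fderiv_snd) hv hvp
  obtain ⟨C, hC⟩ := hwp.exists_bound hw.continuous
  have hs : Summable fun j : ℤ × ℤ => (1 + (j.1 : ℝ) ^ 2)⁻¹ * (1 + (j.2 : ℝ) ^ 2)⁻¹ :=
    summable_int_inv_one_add_sq.mul_of_nonneg summable_int_inv_one_add_sq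
      (fun _ => by positivity) (fun _ => by positivity)
  refine (hs.mul_left C).of_nonneg_of_le (fun _ => norm_nonneg _) fun j => ?_
  have h1 : ‖cCoeff w j‖ ≤ C := norm_cMean_le fun p => by
    rw [norm_mul, norm_mode, mul_one]; exact hC p
  have hn : ∀ n : ℤ, ‖(1 + (n : ℂ) ^ 2)‖ = 1 + (n : ℝ) ^ 2 := fun n => by
    have : (1 + (n : ℂ) ^ 2) = ((1 + (n : ℝ) ^ 2 : ℝ) : ℂ) := by push_cast; rfl
    rw [this, Complex.norm_real, Real.norm_of_nonneg (by positivity)]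
  simp only [hwc, hvc, Complex.ofReal_one, Complex.ofReal_zero, mul_one, mul_zero, add_zero,
    zero_add, norm_mul, hn] at h1
  rw [← mul_inv, ← div_eq_mul_inv, le_div_iff₀ (by positivity)]
  linarith

/-! ### The Banach algebra of nonpositive frequencies. -/

/-- A Fourier mode as a bounded continuous function. -/
def modeB (j : ℤ × ℤ) : (ℝ × ℝ) →ᵇ ℂ :=
  BoundedContinuousFunction.ofNormedAddCommGroup (mode j) (continuous_mode j) 1
    fun p => (norm_mode j p).le

@[simp] lemma modeB_apply (j : ℤ × ℤ) (p : ℝ × ℝ) : modeB j p = mode j p := rfl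

lemma norm_modeB_le (j : ℤ × ℤ) : ‖modeB j‖ ≤ 1 :=
  BoundedContinuousFunction.norm_ofNormedAddCommGroup_le _ zero_le_one _

/-- The mean value over the torus, as a continuous functional on bounded continuous functions. -/
def cMeanCLM : ((ℝ × ℝ) →ᵇ ℂ) →L[ℂ] ℂ :=
  LinearMap.mkContinuous
    { toFun := fun x => cMean x
      map_add' := fun x y => cMean_add x.continuous y.continuous
      map_smul' := fun c x => cMean_const_mul c x } 1
    fun x => by
      rw [one_mul]
      exact norm_cMean_le x.norm_coe_le_norm

/-- The closed algebra generated by the modes of nonpositive frequency. -/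
def lowerAlgebra (k : ℝ) : Subalgebra ℂ ((ℝ × ℝ) →ᵇ ℂ) :=
  (Algebra.adjoin ℂ (modeB '' {j | freq k j ≤ 0})).topologicalClosure

lemma isClosed_lowerAlgebra (k : ℝ) : IsClosed (lowerAlgebra k : Set ((ℝ × ℝ) →ᵇ ℂ)) :=
  Subalgebra.isClosed_topologicalClosure _

lemma modeB_mem_lowerAlgebra {k : ℝ} {j : ℤ × ℤ} (hj : freq k j ≤ 0) :
    modeB j ∈ lowerAlgebra k :=
  Subalgebra.le_topologicalClosure _ (Algebra.subset_adjoin ⟨j, hj, rfl⟩)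

/-- Products of modes are modes and frequencies add, so the generated algebra is just the linear
span of the generators; a continuous functional is therefore controlled by its values on modes. -/
lemma apply_eq_zero_of_mem_lowerAlgebra {k : ℝ} (L : ((ℝ × ℝ) →ᵇ ℂ) →L[ℂ] ℂ)
    (hL : ∀ j, freq k j ≤ 0 → L (modeB j) = 0) {x : (ℝ × ℝ) →ᵇ ℂ} (hx : x ∈ lowerAlgebra k) :
    L x = 0 := by
  have hspan : Subalgebra.toSubmodule (Algebra.adjoin ℂ (modeB '' {j | freq k j ≤ 0})) =
      Submodule.span ℂ (modeB '' {j | freq k j ≤ 0}) := by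
    refine Algebra.adjoin_eq_span_of_subset _ fun y hy => Submodule.subset_span ?_
    induction hy using Submonoid.closure_induction with
    | mem y hy => exact hy
    | one => exact ⟨0, by simp, by ext p; simp⟩
    | mul y z _ _ hy hz =>
      obtain ⟨i, hi, rfl⟩ := hy
      obtain ⟨l, hl, rfl⟩ := hz
      refine ⟨i + l, ?_, by ext p; simp [mode_add]⟩
      simp only [Set.mem_ofPred_eq, freq_add] at hi hl ⊢
      linarith
  have hclosed : IsClosed {y | L y = 0} := isClosed_eq L.continuous continuous_const
  refine closure_minimal (fun y hy => ?_) hclosed hx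
  have hy' : y ∈ Submodule.span ℂ (modeB '' {j | freq k j ≤ 0}) := by
    rw [← hspan]; exact hy
  have hle : Submodule.span ℂ (modeB '' {j | freq k j ≤ 0}) ≤ LinearMap.ker L.toLinearMap := by
    refine Submodule.span_le.2 ?_
    rintro _ ⟨j, hj, rfl⟩
    exact hL j hj
  exact hle hy'

lemma cMean_mode_mul_mode_neg_of_ne {j l : ℤ × ℤ} (h : j ≠ l) : cMean (fun p => mode j p * mode (-l) p) = 0 := by
  simp only [← mode_add]
  rw [show (fun p => mode (j + -l) p) = mode (j + -l) from rfl, cMean_mode, if_neg]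
  rwa [← sub_eq_add_neg, sub_eq_zero]

lemma cCoeff_eq_zero_of_mem_lowerAlgebra {k : ℝ} {x : (ℝ × ℝ) →ᵇ ℂ} (hx : x ∈ lowerAlgebra k)
    {l : ℤ × ℤ} (hl : 0 < freq k l) : cCoeff x l = 0 := by
  refine apply_eq_zero_of_mem_lowerAlgebra
    (cMeanCLM.comp ((ContinuousLinearMap.mul ℂ ((ℝ × ℝ) →ᵇ ℂ)).flip (modeB (-l))))
    (fun j hj => ?_) hx
  exact cMean_mode_mul_mode_neg_of_ne (by rintro rfl; linarith)

/-- The functional `y ↦ P₀[conj(d) y]` vanishes on all modes because the coefficients of `d` do.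
Evaluated at `d` itself, it gives mean square zero. -/
lemma eq_zero_of_mem_lowerAlgebra {k : ℝ} {d : (ℝ × ℝ) →ᵇ ℂ} (hd : d ∈ lowerAlgebra k)
    (hp : CPeriodic d) (h : ∀ j, cCoeff d j = 0) : d = 0 := by
  have h1 := apply_eq_zero_of_mem_lowerAlgebra
    (cMeanCLM.comp (ContinuousLinearMap.mul ℂ ((ℝ × ℝ) →ᵇ ℂ) (star d))) (fun j _ => by
      have h2 := congrArg (starRingEnd ℂ) (h j)
      rw [cCoeff, ← cMean_conj, map_zero] at h2
      rw [← h2]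
      change cMean _ = cMean _
      congr 1
      funext p
      simp [mode_neg]) hd
  ext p
  exact eq_zero_of_cMean_norm_sq d.continuous hp h1 p

lemma summable_smul_modeB {a : ℤ × ℤ → ℂ} (ha : Summable fun j => ‖a j‖) :
    Summable fun j => a j • modeB j :=
  Summable.of_norm (ha.of_nonneg_of_le (fun _ => norm_nonneg _) fun j => by
    rw [norm_smul]
    exact mul_le_of_le_one_right (norm_nonneg _) (norm_modeB_le j))

lemma hasFourierSeries_tsum_smul_modeB {a : ℤ × ℤ → ℂ} (ha : Summable fun j => ‖a j‖) :
    HasFourierSeries a (∑' j, a j • modeB j : (ℝ × ℝ) →ᵇ ℂ) where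
  summable := ha
  hasSum p := by
    have := (summable_smul_modeB ha).hasSum.mapL
      (BoundedContinuousFunction.evalCLM ℂ p : ((ℝ × ℝ) →ᵇ ℂ) →L[ℂ] ℂ)
    simpa using this

lemma tsum_smul_modeB_mem_lowerAlgebra {k : ℝ} {a : ℤ × ℤ → ℂ} (ha : Summable fun j => ‖a j‖)
    (h : ∀ j, 0 < freq k j → a j = 0) : ∑' j, a j • modeB j ∈ lowerAlgebra k := by
  refine (isClosed_lowerAlgebra k).mem_of_tendsto (summable_smul_modeB ha).hasSum
    (Eventually.of_forall fun s => ?_)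
  refine Subalgebra.sum_mem _ fun j _ => ?_
  rcases le_or_gt (freq k j) 0 with hj | hj
  · exact Subalgebra.smul_mem _ (modeB_mem_lowerAlgebra hj) _
  · rw [h j hj, zero_smul]
    exact Subalgebra.zero_mem _

/-- Smoothness makes the Fourier series converge absolutely to some `s` in the algebra. The
difference `x - s` lies in the algebra and has no coefficients, hence vanishes. -/
theorem hasFourierSeries_of_mem_lowerAlgebra {k : ℝ} {x : (ℝ × ℝ) →ᵇ ℂ} (hx : x ∈ lowerAlgebra k)
    (hp : CPeriodic x) (hs : ContDiff ℝ ∞ x) :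
    HasFourierSeries (cCoeff x) x ∧ ∀ j, 0 < freq k j → cCoeff x j = 0 := by
  have hz : ∀ j, 0 < freq k j → cCoeff x j = 0 := fun j =>
    cCoeff_eq_zero_of_mem_lowerAlgebra hx
  have ha := summable_cCoeff hs hp
  have hF := hasFourierSeries_tsum_smul_modeB ha
  have hs' := tsum_smul_modeB_mem_lowerAlgebra ha hz
  set s := ∑' j, cCoeff x j • modeB j
  have h0 : x + (-1 : ℂ) • s = 0 := by
    refine eq_zero_of_mem_lowerAlgebra
      (Subalgebra.add_mem _ hx (Subalgebra.smul_mem _ hs' _)) (fun a b => ?_) fun j => ?_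
    · simp [(hp a b).1, (hp a b).2, (hF.periodic a b).1, (hF.periodic a b).2]
    · have h1 := cCoeff_add (u := x) (v := fun p => (-1 : ℂ) * s p) x.continuous
        (continuous_const.mul s.continuous) j
      rw [cCoeff_const_mul, show cCoeff s j = cCoeff x j from hF.coeff_eq j] at h1
      refine Eq.trans ?_ (h1.trans (by ring))
      rfl
  have : x = s := by
    rw [neg_one_smul, ← sub_eq_add_neg, sub_eq_zero] at h0
    exact h0
  refine ⟨?_, hz⟩
  have h2 : HasFourierSeries (cCoeff x) s := hF
  rwa [← this] at h2

/-- Bounded functions without zeros need not be invertible; periodicity makes the reciprocal bounded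
by compactness. -/
lemma isUnit_of_periodic {x : (ℝ × ℝ) →ᵇ ℂ} (hp : CPeriodic x) (h0 : ∀ p, x p ≠ 0) :
    IsUnit x := by
  have hc : Continuous fun p => (x p)⁻¹ := x.continuous.inv₀ h0
  have hip : CPeriodic fun p => (x p)⁻¹ := fun a b => by
    simp only [(hp a b).1, (hp a b).2, and_self]
  obtain ⟨C, hC⟩ := hip.exists_bound hc
  refine IsUnit.of_mul_eq_one (BoundedContinuousFunction.ofNormedAddCommGroup _ hc C hC) ?_
  ext p
  simp [h0 p]

/-! ### Divided differences along the line and the homotopy from `1` to the tangent. -/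

/-- The divided difference `(e^{i r u} - 1) / u`, extended continuously by `i r` at `u = 0`. -/
def expSlope (r u : ℝ) : ℂ := dslope (fun s : ℝ => Complex.exp (Complex.I * ((r * s : ℝ) : ℂ))) 0 u

lemma hasDerivAt_exp_line (r u : ℝ) :
    HasDerivAt (fun s : ℝ => Complex.exp (Complex.I * ((r * s : ℝ) : ℂ)))
      (Complex.exp (Complex.I * ((r * u : ℝ) : ℂ)) * (Complex.I * r)) u := by
  have h1 : HasDerivAt (fun s : ℝ => ((r * s : ℝ) : ℂ)) r u := by
    simpa using ((hasDerivAt_id u).const_mul r).ofReal_comp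
  exact (h1.const_mul Complex.I).cexp

lemma expSlope_zero (r : ℝ) : expSlope r 0 = Complex.I * r := by
  rw [expSlope, dslope_same, (hasDerivAt_exp_line r 0).deriv]
  simp

lemma expSlope_of_ne (r : ℝ) {u : ℝ} (hu : u ≠ 0) :
    expSlope r u = (Complex.exp (Complex.I * ((r * u : ℝ) : ℂ)) - 1) / u := by
  rw [expSlope, dslope_of_ne _ hu, slope_def_module, sub_zero, Complex.real_smul]
  simp [div_eq_inv_mul]

lemma continuous_expSlope (r : ℝ) : Continuous (expSlope r) := by
  refine continuous_iff_continuousAt.2 fun u => ?_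
  rcases eq_or_ne u 0 with rfl | hu
  · exact continuousAt_dslope_same.2 (hasDerivAt_exp_line r 0).differentiableAt
  · exact (continuousAt_dslope_of_ne hu).2 (hasDerivAt_exp_line r u).continuousAt

/-- Uniform in `u`: it gives norm continuity of the path of divided differences down to `u = 0`. -/
lemma norm_expSlope_le (r u : ℝ) : ‖expSlope r u‖ ≤ |r| := by
  rcases eq_or_ne u 0 with rfl | hu
  · simp [expSlope_zero]
  · rw [expSlope_of_ne r hu, norm_div, Complex.norm_real, Real.norm_eq_abs,
      div_le_iff₀ (abs_pos.2 hu), ← abs_mul]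
    exact Real.norm_exp_I_mul_ofReal_sub_one_le

/-- Uniform in the frequency: it brings the divided differences close to `1` for large `u`. -/
lemma norm_expSlope_le_div (r : ℝ) {u : ℝ} (hu : 0 < u) : ‖expSlope r u‖ ≤ 2 / u := by
  rw [expSlope_of_ne r hu.ne', norm_div, Complex.norm_real, Real.norm_of_nonneg hu.le]
  gcongr
  refine (norm_sub_le _ _).trans ?_
  rw [Complex.norm_exp_I_mul_ofReal, norm_one]
  norm_num

section ChordPath

variable {k : ℝ} {b : ℤ × ℤ → ℂ}

/-- The divided differences of `α + ζ(α)` along the line, as bounded functions on the torus. -/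
def chordSlope (k : ℝ) (b : ℤ × ℤ → ℂ) (u : ℝ) : (ℝ × ℝ) →ᵇ ℂ :=
  1 + ∑' j, (b j * expSlope (freq k j) u) • modeB j

lemma summable_abs_freq_mul_norm (hb : RapidDecay b) : Summable fun j => |freq k j| * ‖b j‖ := by
  have := (hb.mul_freq (k := k)).summable
  refine this.congr fun j => ?_
  simp

lemma norm_chord_coeff_le (u : ℝ) (j : ℤ × ℤ) :
    ‖b j * expSlope (freq k j) u‖ ≤ |freq k j| * ‖b j‖ := by
  rw [norm_mul, mul_comm]
  gcongr
  exact norm_expSlope_le _ _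

lemma summable_chord_coeff (hb : RapidDecay b) (u : ℝ) :
    Summable fun j => ‖b j * expSlope (freq k j) u‖ :=
  (summable_abs_freq_mul_norm hb).of_nonneg_of_le (fun _ => norm_nonneg _) (norm_chord_coeff_le u)

lemma continuous_chordSlope (hb : RapidDecay b) : Continuous (chordSlope k b) := by
  refine continuous_const.add (continuous_tsum (fun j => ?_) (summable_abs_freq_mul_norm (k := k) hb)
    fun j u => ?_)
  · exact (continuous_const.mul (continuous_expSlope _)).smul continuous_const
  · rw [norm_smul]
    exact (mul_le_of_le_one_right (norm_nonneg _) (norm_modeB_le j)).trans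
      (norm_chord_coeff_le u j)

lemma chordSlope_mem (hb : RapidDecay b) (hb0 : ∀ j, 0 < freq k j → b j = 0) (u : ℝ) :
    chordSlope k b u ∈ lowerAlgebra k :=
  Subalgebra.add_mem _ (Subalgebra.one_mem _)
    (tsum_smul_modeB_mem_lowerAlgebra (summable_chord_coeff hb u) fun j hj => by
      rw [hb0 j hj, zero_mul])

lemma chordSlope_periodic (hb : RapidDecay b) (u : ℝ) : CPeriodic (chordSlope k b u) := by
  intro x y
  have := (hasFourierSeries_tsum_smul_modeB (summable_chord_coeff (k := k) hb u)).periodic x y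
  simp [chordSlope, this.1, this.2]

lemma chordSlope_zero_apply (hb : RapidDecay b) {D : ℝ × ℝ → ℂ}
    (hD : HasFourierSeries (fun j => Complex.I * freq k j * b j) D) (p : ℝ × ℝ) :
    chordSlope k b 0 p = 1 + D p := by
  have h1 := (hasFourierSeries_tsum_smul_modeB (summable_chord_coeff (k := k) hb 0)).congr_coeff
    (b := fun j => Complex.I * freq k j * b j) fun j => by rw [expSlope_zero]; ring
  rw [hD.unique h1]
  rfl

/-- The right-hand side is a chord of the curve `α + ζ`, so injectivity makes `chordSlope` nonzero
for `u ≠ 0`. -/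
lemma chordSlope_apply_mul (hb : RapidDecay b) {ζ : ℝ × ℝ → ℂ} (hζ : HasFourierSeries b ζ)
    {u : ℝ} (hu : u ≠ 0) (p : ℝ × ℝ) :
    (u : ℂ) * chordSlope k b u p = u + ζ (p + u • (1, k)) - ζ p := by
  have h1 := ((hasFourierSeries_tsum_smul_modeB
    (summable_chord_coeff (k := k) hb u)).const_mul u).hasSum p
  have h2 := (hζ.hasSum (p + u • (1, k))).sub (hζ.hasSum p)
  have hu' : (u : ℂ) ≠ 0 := by exact_mod_cast hu
  have h3 := h2.unique (h1.congr_fun fun j => by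
    rw [mode_line, expSlope_of_ne _ hu]
    field_simp)
  change (u : ℂ) * (1 + (∑' j, (b j * expSlope (freq k j) u) • modeB j : (ℝ × ℝ) →ᵇ ℂ) p) = _
  rw [mul_add, ← h3]
  ring

lemma norm_chordSlope_sub_one_le (hb : RapidDecay b) {u : ℝ} (hu : 0 < u) :
    ‖1 - chordSlope k b u‖ ≤ (∑' j, ‖b j‖) * (2 / u) := by
  rw [chordSlope, sub_add_cancel_left, norm_neg, ← tsum_mul_right]
  refine tsum_of_norm_bounded (hb.summable.mul_right _).hasSum fun j => ?_
  rw [norm_smul, norm_mul]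
  refine (mul_le_of_le_one_right (by positivity) (norm_modeB_le j)).trans ?_
  gcongr
  exact norm_expSlope_le_div _ hu

/-- A connectedness argument in `u`. Every element of the path is invertible among bounded
functions; the question is whether the inverse stays in the closed subalgebra. That condition is
closed, because inversion is continuous, and open, because the units of the complete subalgebra form
an open set. -/
theorem inverse_chordSlope_zero_mem (hb : RapidDecay b) (hb0 : ∀ j, 0 < freq k j → b j = 0)
    (hne : ∀ u p, chordSlope k b u p ≠ 0) :
    Ring.inverse (chordSlope k b 0) ∈ lowerAlgebra k := by
  have hunit : ∀ u, IsUnit (chordSlope k b u) := fun u =>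
    isUnit_of_periodic (chordSlope_periodic hb u) (hne u)
  have hinv : Continuous fun u => Ring.inverse (chordSlope k b u) := by
    refine continuous_iff_continuousAt.2 fun u => ?_
    obtain ⟨w, hw⟩ := hunit u
    have h := NormedRing.inverse_continuousAt w
    rw [hw] at h
    exact ContinuousAt.comp (f := chordSlope k b) h (continuous_chordSlope hb).continuousAt
  set G : Set ℝ := {u | Ring.inverse (chordSlope k b u) ∈ lowerAlgebra k} with hG
  have hGclosed : IsClosed G := (isClosed_lowerAlgebra k).preimage hinv
  have : CompleteSpace (lowerAlgebra k) := (isClosed_lowerAlgebra k).completeSpace_coe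
  let Q : ℝ → lowerAlgebra k := fun u => ⟨chordSlope k b u, chordSlope_mem hb hb0 u⟩
  have hQ : Continuous Q := (continuous_chordSlope hb).subtype_mk _
  -- By uniqueness of inverses, having the inverse in the subalgebra is the same as being a unit of
  -- the subalgebra.
  have hGQ : G = {u | IsUnit (Q u)} := by
    ext u
    constructor
    · intro hu
      exact IsUnit.of_mul_eq_one ⟨_, hu⟩ (Subtype.ext (Ring.mul_inverse_cancel _ (hunit u)))
    · rintro ⟨w, hw⟩
      have h1 : chordSlope k b u * ((w⁻¹ : (lowerAlgebra k)ˣ) : lowerAlgebra k) = 1 := by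
        have := congrArg Subtype.val w.mul_inv
        rw [hw] at this
        exact this
      have h2 : Ring.inverse (chordSlope k b u) =
          ((w⁻¹ : (lowerAlgebra k)ˣ) : lowerAlgebra k) := by
        rw [← mul_one (Ring.inverse (chordSlope k b u)), ← h1,
          Ring.inverse_mul_cancel_left _ _ (hunit u)]
      change Ring.inverse (chordSlope k b u) ∈ lowerAlgebra k
      rw [h2]
      exact Subtype.property _
  have hGopen : IsOpen G := by
    rw [hGQ]
    exact Units.isOpen.preimage hQ
  have hGne : G.Nonempty := by
    set S := ∑' j, ‖b j‖ with hS
    have hS0 : 0 ≤ S := tsum_nonneg fun _ => norm_nonneg _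
    -- At this `u` the distance to `1` is at most `2 S / (2 S + 1) < 1`, so the Neumann series
    -- inverts the element inside the subalgebra.
    refine ⟨2 * S + 1, ?_⟩
    rw [hGQ]
    have h1 : ‖1 - Q (2 * S + 1)‖ < 1 := by
      refine (norm_chordSlope_sub_one_le (k := k) hb (u := 2 * S + 1) (by linarith)).trans_lt ?_
      rw [← hS, mul_div_assoc', div_lt_one (by linarith)]
      linarith
    have h2 := isUnit_one_sub_of_norm_lt_one h1
    rwa [sub_sub_cancel] at h2
  have huniv : G = Set.univ := IsClopen.eq_univ ⟨hGclosed, hGopen⟩ hGne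
  have : (0 : ℝ) ∈ G := by rw [huniv]; trivial
  exact this

end ChordPath

/-- The reciprocal of the tangent of an injective curve whose periodic part has only nonpositive
frequencies has an absolutely convergent Fourier series with only nonpositive frequencies. -/
theorem exists_hasFourierSeries_inv {k : ℝ} {b : ℤ × ℤ → ℂ} {ζ D : ℝ × ℝ → ℂ} (hb : RapidDecay b)
    (hb0 : ∀ j, 0 < freq k j → b j = 0) (hζ : HasFourierSeries b ζ)
    (hD : HasFourierSeries (fun j => Complex.I * freq k j * b j) D)
    (hinj : ∀ (p : ℝ × ℝ) (u : ℝ), u ≠ 0 → (u : ℂ) + ζ (p + u • (1, k)) - ζ p ≠ 0)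
    (hreg : ∀ p, 1 + D p ≠ 0) :
    ∃ w, HasFourierSeries w (fun p => (1 + D p)⁻¹) ∧ ∀ j, 0 < freq k j → w j = 0 := by
  have hne : ∀ u p, chordSlope k b u p ≠ 0 := by
    intro u p h
    rcases eq_or_ne u 0 with rfl | hu
    · exact hreg p (by rw [← chordSlope_zero_apply hb hD, h])
    · exact hinj p u hu (by rw [← chordSlope_apply_mul hb hζ hu, h, mul_zero])
  obtain ⟨y, hy⟩ : ∃ y, y = Ring.inverse (chordSlope k b 0) := ⟨_, rfl⟩
  have hmem : y ∈ lowerAlgebra k := hy ▸ inverse_chordSlope_zero_mem hb hb0 hne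
  have heq : (y : ℝ × ℝ → ℂ) = fun p => (1 + D p)⁻¹ := by
    funext p
    have h1 := DFunLike.congr_fun (Ring.mul_inverse_cancel (chordSlope k b 0)
      (isUnit_of_periodic (chordSlope_periodic hb 0) (hne 0))) p
    rw [← hy, BoundedContinuousFunction.mul_apply, chordSlope_zero_apply hb hD] at h1
    exact eq_inv_of_mul_eq_one_right h1
  have hper : CPeriodic y := by
    rw [heq]
    intro x y
    simp only [(hD.periodic x y).1, (hD.periodic x y).2, and_self]
  -- Membership in the closure alone gives no absolute convergence; smoothness of the reciprocal
  -- supplies it.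
  have hDs : ContDiff ℝ ∞ D :=
    contDiff_iff_forall_nat_le.2 fun m _ => hD.contDiff_nat m hb.mul_freq
  have hsm : ContDiff ℝ ∞ y := by
    rw [heq]
    exact (contDiff_const.add hDs).inv hreg
  obtain ⟨h1, h2⟩ := hasFourierSeries_of_mem_lowerAlgebra hmem hper hsm
  exact ⟨_, h1.congr_fun fun p => (congrFun heq p).symm, h2⟩

/-! ### Hilbert conjugates of real and imaginary parts. -/

lemma CPeriodic.torusPeriodic {u : ℝ × ℝ → ℝ} (h : CPeriodic fun p => (u p : ℂ)) :
    TorusPeriodic u := fun x y => by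
  have := h x y
  simpa only [Complex.ofReal_inj] using this

lemma hilbertSymbol_sq {k : ℝ} (hk : Irrational k) {j : ℤ × ℤ} (hj : j ≠ 0) :
    hilbertSymbol k j * hilbertSymbol k j = -1 := by
  have h0 : freq k j ≠ 0 := fun h => hj ((freq_eq_zero hk).1 h)
  have hs : Real.sign (freq k j) * Real.sign (freq k j) = 1 := by
    rcases Real.sign_apply_eq_of_ne_zero _ h0 with h | h <;> simp [h]
  have hs' : (Real.sign (freq k j) : ℂ) * (Real.sign (freq k j) : ℂ) = 1 := by exact_mod_cast hs
  unfold hilbertSymbol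
  linear_combination (Complex.I * Complex.I) * hs' + Complex.I_mul_I

@[simp] lemma hilbertSymbol_zero (k : ℝ) : hilbertSymbol k 0 = 0 := by simp [hilbertSymbol]

/-- `H² = P₀ - id`; it identifies `ψ = -H[φ]` when `φ = c H[η]`. -/
lemma HasFourierSeries.hilbert_hilbert {k : ℝ} (hk : Irrational k) {a : ℤ × ℤ → ℂ}
    {u : ℝ × ℝ → ℝ} (hu : HasFourierSeries a fun p => (u p : ℂ)) :
    HasFourierSeries (fun j => hilbertSymbol k j * (hilbertSymbol k j * a j))
      fun p => ((torusMean u - u p : ℝ) : ℂ) := by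
  refine ((((hu.const_mul (-1)).add_const (torusMean u)).congr_coeff fun j => ?_)).congr_fun
    fun p => by push_cast; ring
  rw [← mul_assoc]
  rcases eq_or_ne j 0 with rfl | hj
  · simp [hu.torusMean_eq]
  · simp [hj, hilbertSymbol_sq hk hj]

lemma HasFourierSeries.re {w : ℤ × ℤ → ℂ} {h : ℝ × ℝ → ℂ} (hw : HasFourierSeries w h) :
    HasFourierSeries (fun j => (1 / 2) * (w j + (starRingEnd ℂ) (w (-j))))
      fun p => ((h p).re : ℂ) :=
  ((hw.add hw.star).const_mul (1 / 2)).congr_fun fun p => by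
    rw [Complex.add_conj]; push_cast; ring

lemma HasFourierSeries.im {w : ℤ × ℤ → ℂ} {h : ℝ × ℝ → ℂ} (hw : HasFourierSeries w h) :
    HasFourierSeries (fun j => (-Complex.I / 2) * (w j + (-1) * (starRingEnd ℂ) (w (-j))))
      fun p => ((h p).im : ℂ) :=
  ((hw.add (hw.star.const_mul (-1))).const_mul (-Complex.I / 2)).congr_fun fun p => by
    rw [neg_one_mul, ← sub_eq_add_neg, Complex.sub_conj]
    push_cast
    linear_combination ((h p).im : ℂ) * Complex.I_mul_I

/-- Real and imaginary part of a function with nonpositive frequencies are Hilbert conjugate. -/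
lemma HasFourierSeries.hilbert_im {k : ℝ} (hk : Irrational k) {w : ℤ × ℤ → ℂ} {h : ℝ × ℝ → ℂ}
    (hw : HasFourierSeries w h) (hw0 : ∀ j, 0 < freq k j → w j = 0) :
    HasFourierSeries (fun j => hilbertSymbol k j *
        ((-Complex.I / 2) * (w j + (-1) * (starRingEnd ℂ) (w (-j)))))
      fun p => (((h p).re - torusMean (fun q => (h q).re) : ℝ) : ℂ) := by
  refine ((hw.re.add_const (-(torusMean fun q => (h q).re : ℂ))).congr_coeff fun j => ?_).congr_fun
    fun p => by push_cast; ring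
  rw [hw.re.torusMean_eq]
  -- Away from frequency zero only one of `w j` and `w (-j)` survives, and the multiplier supplies
  -- the matching sign; at zero, subtracting the mean removes the coefficient.
  rcases lt_trichotomy (freq k j) 0 with hj | hj | hj
  · have h1 : w (-j) = 0 := hw0 _ (by rw [freq_neg]; linarith)
    have h2 : j ≠ 0 := by rintro rfl; simp at hj
    simp only [hilbertSymbol, Real.sign_of_neg hj, h1, h2, if_false]
    push_cast
    simp only [map_zero, mul_zero, add_zero]
    linear_combination (-(w j) / 2) * Complex.I_mul_I
  · rw [(freq_eq_zero hk).1 hj]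
    simp
  · have h1 : w j = 0 := hw0 _ hj
    have h2 : j ≠ 0 := by rintro rfl; simp at hj
    simp only [hilbertSymbol, Real.sign_of_pos hj, h1, h2, if_false]
    push_cast
    simp only [zero_add, add_zero]
    linear_combination (-(starRingEnd ℂ (w (-j))) / 2) * Complex.I_mul_I

/-! ### Restriction from the torus to a line. -/

lemma torusMean_shift_snd {U : ℝ × ℝ → ℝ} (hU : TorusPeriodic U) (θ : ℝ) :
    torusMean (fun p => U (p.1, p.2 + θ)) = torusMean U := by
  unfold torusMean
  congr 2
  funext x
  rw [intervalIntegral.integral_comp_add_right (fun y => U (x, y)) θ, zero_add, add_comm]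
  have := (show Function.Periodic (fun y => U (x, y)) (2 * Real.pi) from
    fun y => (hU x y).2).intervalIntegral_add_eq θ 0
  rwa [zero_add] at this

/-- The phase `θ` is absorbed by translating `U` in its second variable, which does not change the
mean. Hence means along the line do not depend on `θ`. -/
lemma hasMean_line {U : ℝ × ℝ → ℝ} (hc : Continuous U) (hU : TorusPeriodic U) (k θ : ℝ) :
    HasMean k (fun α => U (α, θ + k * α)) (torusMean U) := by
  refine ⟨fun p => U (p.1, p.2 + θ), hc.comp (by fun_prop), fun x y => ⟨(hU x _).1, ?_⟩,
    fun α => by simp only [add_comm], (torusMean_shift_snd hU θ).symm⟩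
  simp only
  rw [add_right_comm]
  exact (hU x (y + θ)).2

lemma TorusAnalytic.quasiPeriodic {U : ℝ × ℝ → ℝ} (hU : TorusAnalytic U) (k θ : ℝ) :
    QuasiPeriodic k fun α => U (α, θ + k * α) :=
  ⟨_, hU.shift (0, θ), fun α => by simp [add_comm]⟩

lemma TorusAnalytic.deriv_add_line {U : ℝ × ℝ → ℝ} (hU : TorusAnalytic U) (k θ α : ℝ) :
    deriv (fun s => s + U (s, θ + k * s)) α = 1 + torusDeriv k U (α, θ + k * α) := by
  obtain ⟨a, ha, hu⟩ := hU.exists_hasFourierSeries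
  have h := (hasDerivAt_id α).add (hu.hasDerivAt_torusDeriv (k := k) ha (0, θ) α)
  have h2 : ∀ s : ℝ, (0, θ) + s • ((1, k) : ℝ × ℝ) = (s, θ + k * s) := fun s => by
    simp [mul_comm]
  simp only [h2] at h
  exact h.deriv

/-- The restriction of a solution of the torus system to a line solves the system on the line. -/
theorem TorusSystem.lineSystem {k g τ : ℝ} {C₁ x₀ : ℝ → ℝ}
    {ξ η φ X ψ J χ Hχ B : ℝ → ℝ × ℝ → ℝ} (h : TorusSystem k g τ C₁ x₀ ξ η φ X ψ J χ Hχ B)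
    (hχ : ∀ t, ∃ a, HasFourierSeries a fun p => (χ t p : ℂ))
    (hV : ∀ t, Continuous (fun p => X t p * (-Hχ t p + C₁ t) - torusDeriv k (η t) p * (-χ t p)) ∧
      TorusPeriodic (fun p => X t p * (-Hχ t p + C₁ t) - torusDeriv k (η t) p * (-χ t p)))
    (hB : ∀ t, Continuous (B t) ∧ TorusPeriodic (B t)) (θ : ℝ) :
    LineSystem k g τ C₁ x₀ (fun t α => α + ξ t (α, θ + k * α)) (fun t α => η t (α, θ + k * α))
      (fun t α => φ t (α, θ + k * α)) (fun t α => ψ t (α, θ + k * α))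
      (fun t α => J t (α, θ + k * α)) (fun t α => χ t (α, θ + k * α))
      (fun t α => Hχ t (α, θ + k * α)) (fun t α => B t (α, θ + k * α)) := by
  have hξ' : ∀ t, deriv (fun α => α + ξ t (α, θ + k * α)) = fun α => X t (α, θ + k * α) := by
    intro t
    funext α
    rw [(h.analytic_xi t).deriv_add_line, h.X_eq]
  have hu' : ∀ u : ℝ × ℝ → ℝ, deriv (fun α => u (α, θ + k * α)) =
      fun α => torusDeriv k u (α, θ + k * α) := fun u => funext fun α => deriv_line k u θ α
  refine ⟨fun t => ?_, fun t => (h.analytic_eta t).quasiPeriodic k θ,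
    fun t => (h.analytic_phi t).quasiPeriodic k θ,
    fun t => (h.analytic_psi t).quasiPeriodic k θ, fun t α => ?_, fun t α => ?_, fun t α => ?_,
    fun t α => ?_, fun t α => h.J_ne t _, fun t α => ?_, fun t α => ?_, fun t => ?_,
    fun t α => ?_, fun t α => ?_, fun t => ?_⟩
  · simp only [add_sub_cancel_left]
    exact (h.analytic_xi t).quasiPeriodic k θ
  · obtain ⟨a, -, hu⟩ := (h.analytic_eta t).exists_hasFourierSeries
    rw [add_sub_cancel_left]
    exact (h.xi_eq t).hasLineHilbert hu θ α
  · obtain ⟨a, ha, hu⟩ := (h.analytic_eta t).exists_hasFourierSeries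
    rw [hξ', hu']
    exact (h.xi_deriv t).hasLineHilbert (hu.torusDeriv ha) θ α
  · obtain ⟨a, -, hu⟩ := (h.analytic_phi t).exists_hasFourierSeries
    exact (h.psi_eq t).hasLineHilbert hu θ α
  · rw [hξ', hu', h.J_eq]
  · rw [hu', h.chi_eq]
  · obtain ⟨a, hu⟩ := hχ t
    exact (h.hchi_eq t).hasLineHilbert hu θ α
  · refine ⟨_, ?_, h.x0_evol t⟩
    rw [hξ', hu']
    exact hasMean_line (hV t).1 (hV t).2 k θ
  · rw [hξ', hu']
    exact h.eta_evol t _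
  · rw [hξ', hu', hu', hu', hu', hu', h.B_eq]
  · exact ⟨_, hasMean_line (hB t).1 (hB t).2 k θ, fun α => h.phi_evol t _⟩

/-! ### Verification of the equations of motion for a wave profile. -/

/-- The tangent component `ξ_α = 1 + (∂_{α₁} + k ∂_{α₂}) ξ`. -/
def tangent (k : ℝ) (ξ : ℝ × ℝ → ℝ) (p : ℝ × ℝ) : ℝ := 1 + torusDeriv k ξ p

/-- The squared length `J = ξ_α² + η_α²` of the tangent. -/
def jacobian (k : ℝ) (ξ η : ℝ × ℝ → ℝ) (p : ℝ × ℝ) : ℝ :=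
  tangent k ξ p ^ 2 + torusDeriv k η p ^ 2

/-- The properties of a traveling wave profile that make it a solution of the equations of
motion: `m` is the mean of `ξ_α / J`, and `K` is the Bernoulli constant. -/
structure WaveProfile (k c g τ : ℝ) (ξ η : ℝ × ℝ → ℝ) (m K : ℝ) : Prop where
  irrational : Irrational k
  analytic : TorusAnalytic η
  hilbert : IsTorusHilbert k η ξ
  jacobian_ne : ∀ p, jacobian k ξ η p ≠ 0
  quotient : ∃ y, HasFourierSeries y (fun p => ((torusDeriv k η p / jacobian k ξ η p : ℝ) : ℂ)) ∧
    HasFourierSeries (fun j => hilbertSymbol k j * y j)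
      (fun p => ((m - tangent k ξ p / jacobian k ξ η p : ℝ) : ℂ))
  bernoulli : ∀ p, c ^ 2 / (2 * jacobian k ξ η p) + g * η p
      - τ * curvature (tangent k ξ p) (torusDeriv k η p) (torusDeriv k (tangent k ξ) p)
          (torusDeriv k (torusDeriv k η) p) = K

namespace WaveProfile

variable {k c g τ : ℝ} {ξ η : ℝ × ℝ → ℝ} {m K : ℝ}

lemma analytic_xi (h : WaveProfile k c g τ ξ η m K) : TorusAnalytic ξ :=
  h.analytic.hilbert h.hilbert

lemma exists_series (h : WaveProfile k c g τ ξ η m K) :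
    ∃ a, RapidDecay a ∧ HasFourierSeries a (fun p => (η p : ℂ)) ∧
      RapidDecay (fun j => hilbertSymbol k j * a j) ∧
      HasFourierSeries (fun j => hilbertSymbol k j * a j) (fun p => (ξ p : ℂ)) := by
  obtain ⟨a, ha, hu⟩ := h.analytic.exists_hasFourierSeries
  exact ⟨a, ha, hu, ha.mul_bounded (norm_hilbertSymbol_le k), h.hilbert.hasFourierSeries hu⟩

lemma hasFourierSeries_tangent (h : WaveProfile k c g τ ξ η m K) :
    ∃ b, b 0 = 1 ∧ HasFourierSeries b (fun p => (tangent k ξ p : ℂ)) := by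
  obtain ⟨a, -, -, hb, hξ⟩ := h.exists_series
  exact ⟨_, by simp, ((hξ.torusDeriv (k := k) hb).add_const 1).congr_fun fun p => by
    simp [tangent, add_comm]⟩

/-- The right-hand side of the evolution equation of `x₀` is affine in `ξ_α`. -/
lemma drift_eq (h : WaveProfile k c g τ ξ η m K) (a : ℝ) (p : ℝ × ℝ) :
    tangent k ξ p * (-(c * (m - tangent k ξ p / jacobian k ξ η p)) + (c * m - a)) -
      torusDeriv k η p * (-(c * (torusDeriv k η p / jacobian k ξ η p))) =
      c - a * tangent k ξ p := by
  have hJ := h.jacobian_ne p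
  have hJe : jacobian k ξ η p = tangent k ξ p ^ 2 + torusDeriv k η p ^ 2 := rfl
  field_simp
  rw [hJe]
  ring

/-- The two terms with `c ξ_α η_α / J` cancel, and so do those with `c m η_α`; only the
reparametrization speed `a = α₀'` is left. -/
lemma kinematic_eq (h : WaveProfile k c g τ ξ η m K) (a : ℝ) (p : ℝ × ℝ) :
    -torusDeriv k η p * (c * (m - tangent k ξ p / jacobian k ξ η p)) -
      tangent k ξ p * (c * (torusDeriv k η p / jacobian k ξ η p)) +
      (c * m - a) * torusDeriv k η p = torusDeriv k η p * -a := by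
  have hJ := h.jacobian_ne p
  field_simp
  ring

/-- With `φ_α = c (ξ_α - 1)` the quadratic terms and the `ξ_α / J` part of `H[χ]` combine to `c² (J
- 1) / (2 J)`. The Bernoulli equation then turns the `-c² / (2 J)`, gravity and capillary terms into
`-K`. -/
lemma dynamic_eq (h : WaveProfile k c g τ ξ η m K) (a : ℝ) (p : ℝ × ℝ) :
    c ^ 2 / 2 - K - a * (c * torusDeriv k ξ p) =
      ((c * torusDeriv k η p) ^ 2 - (c * torusDeriv k ξ p) ^ 2) / (2 * jacobian k ξ η p)
      - c * torusDeriv k ξ p * (c * (m - tangent k ξ p / jacobian k ξ η p))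
      + (c * m - a) * (c * torusDeriv k ξ p) - g * η p
      + τ * curvature (tangent k ξ p) (torusDeriv k η p) (torusDeriv k (tangent k ξ) p)
          (torusDeriv k (torusDeriv k η) p) := by
  have hJ := h.jacobian_ne p
  have hJe : jacobian k ξ η p = tangent k ξ p ^ 2 + torusDeriv k η p ^ 2 := rfl
  rw [← h.bernoulli p]
  generalize curvature (tangent k ξ p) (torusDeriv k η p) (torusDeriv k (tangent k ξ) p)
          (torusDeriv k (torusDeriv k η) p) = κ
  have hx : torusDeriv k ξ p = tangent k ξ p - 1 := by simp [tangent]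
  rw [hx]
  field_simp
  rw [hJe]
  ring

/-- The translation of the torus by `-a` along the direction `(1, k)`. -/
def along (k a : ℝ) (p : ℝ × ℝ) : ℝ × ℝ := p + (-a) • (1, k)

lemma along_eq (k a : ℝ) (p : ℝ × ℝ) : along k a p = (p.1 - a, p.2 - k * a) := by
  ext <;> simp [along] <;> ring

lemma torusDeriv_along (u : ℝ × ℝ → ℝ) (a : ℝ) (p : ℝ × ℝ) :
    torusDeriv k (fun q => u (along k a q)) p = torusDeriv k u (along k a p) :=
  torusDeriv_shift k u _ p

lemma hasFourierSeries_along {a : ℤ × ℤ → ℂ} {u : ℝ × ℝ → ℝ}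
    (hu : HasFourierSeries a fun p => (u p : ℂ)) (s : ℝ) :
    HasFourierSeries (fun j => a j * mode j ((-s) • (1, k))) fun p => (u (along k s p) : ℂ) :=
  hu.shift _

lemma isTorusHilbert_along {a : ℤ × ℤ → ℂ} {u v : ℝ × ℝ → ℝ}
    (hu : HasFourierSeries a fun p => (u p : ℂ))
    (hv : HasFourierSeries (fun j => hilbertSymbol k j * a j) fun p => (v p : ℂ)) (c s : ℝ) :
    IsTorusHilbert k (fun p => c * u (along k s p)) (fun p => c * v (along k s p)) := by
  refine (((hasFourierSeries_along (k := k) hu s).const_mul c).congr_fun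
    fun p => by push_cast; rfl).isTorusHilbert ?_
  refine (((hasFourierSeries_along (k := k) hv s).const_mul c).congr_fun
    fun p => by push_cast; rfl).congr_coeff fun j => by ring

lemma torusMean_along {a : ℤ × ℤ → ℂ} {u : ℝ × ℝ → ℝ}
    (hu : HasFourierSeries a fun p => (u p : ℂ)) (s : ℝ) :
    torusMean (fun p => u (along k s p)) = torusMean u := by
  have h1 := (hasFourierSeries_along (k := k) hu s).torusMean_eq
  rw [mode_zero, mul_one, ← hu.torusMean_eq] at h1
  exact_mod_cast h1

lemma hasFourierSeries_const_sub_tangent (h : WaveProfile k c g τ ξ η m K) (A a s : ℝ) :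
    ∃ b : ℤ × ℤ → ℂ, b 0 = A - a ∧
      HasFourierSeries b fun p => ((A - a * tangent k ξ (along k s p) : ℝ) : ℂ) := by
  obtain ⟨b, hb, hu⟩ := h.hasFourierSeries_tangent
  refine ⟨fun j => -a * (b j * mode j ((-s) • (1, k))) + if j = 0 then (A : ℂ) else 0, ?_,
    (((hasFourierSeries_along (k := k) hu s).const_mul (-a)).add_const A).congr_fun fun p => by
      push_cast; ring⟩
  simp only [hb, mode_zero, if_true]
  ring

lemma torusMean_const_sub_tangent (h : WaveProfile k c g τ ξ η m K) (A a s : ℝ) :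
    torusMean (fun p => A - a * tangent k ξ (along k s p)) = A - a := by
  obtain ⟨b, hb, hu⟩ := h.hasFourierSeries_const_sub_tangent A a s
  have := hu.torusMean_eq
  rw [hb] at this
  exact_mod_cast this

/-- The time dependence is a translation in the direction `(1, k)`, so time derivatives are
multiples of `torusDeriv`. -/
lemma hasDerivAt_along {u : ℝ × ℝ → ℝ} (hu : TorusAnalytic u) {f : ℝ → ℝ} {f' t : ℝ}
    (hf : HasDerivAt f f' t) (p : ℝ × ℝ) :
    HasDerivAt (fun s => u (along k (f s) p)) (torusDeriv k u (along k (f t) p) * -f') t := by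
  obtain ⟨a, ha, hs⟩ := hu.exists_hasFourierSeries
  exact (hs.hasDerivAt_torusDeriv (k := k) ha p (-f t)).comp t hf.neg

theorem torusSystem (h : WaveProfile k c g τ ξ η m K) {α₀ : ℝ → ℝ} (hα : Differentiable ℝ α₀) :
    TorusSystem k g τ (fun t => c * m - deriv α₀ t) (fun t => c * t - α₀ t)
      (fun t p => ξ (along k (α₀ t) p) + (c * t - α₀ t)) (fun t p => η (along k (α₀ t) p))
      (fun t p => c * ξ (along k (α₀ t) p)) (fun t p => tangent k ξ (along k (α₀ t) p))
      (fun t p => c * η (along k (α₀ t) p) + -(c * torusMean η))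
      (fun t p => jacobian k ξ η (along k (α₀ t) p))
      (fun t p => c * (torusDeriv k η (along k (α₀ t) p) / jacobian k ξ η (along k (α₀ t) p)))
      (fun t p => c * (m - tangent k ξ (along k (α₀ t) p) / jacobian k ξ η (along k (α₀ t) p)))
      (fun t p => c ^ 2 / 2 - K - deriv α₀ t * (c * torusDeriv k ξ (along k (α₀ t) p))) := by
  obtain ⟨a, ha, hη, hb, hξ⟩ := h.exists_series
  obtain ⟨y, hy, hy'⟩ := h.quotient
  have hα' : ∀ t, HasDerivAt α₀ (deriv α₀ t) t := fun t => (hα t).hasDerivAt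
  have hDη := hη.torusDeriv (k := k) ha
  have hDξ := hξ.torusDeriv (k := k) hb
  refine ⟨fun t => (h.analytic_xi.shift _).add (TorusAnalytic.const _),
    fun t => h.analytic.shift _, fun t => (h.analytic_xi.shift _).const_mul c,
    fun t => ((h.analytic.shift _).const_mul c).add (TorusAnalytic.const _), fun t => ?_,
    fun t p => ?_, fun t => ?_, fun t => ?_, fun t p => ?_, fun t p => h.jacobian_ne _,
    fun t p => ?_, fun t => isTorusHilbert_along hy hy' c _, fun t => ?_, fun t p => ?_,
    fun t p => ?_, fun t p => ?_⟩
  · simpa using isTorusHilbert_along (k := k) hη hξ 1 (α₀ t)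
  · rw [torusDeriv_add_const, torusDeriv_along, tangent]
  · have := isTorusHilbert_along (k := k) hDη
      (hDξ.congr_coeff fun j => by ring) 1 (α₀ t)
    simp only [one_mul] at this
    convert this using 1
    · funext p
      rw [torusDeriv_along]
    · funext p
      simp [tangent]
  · have := isTorusHilbert_along (k := k) hξ (hη.hilbert_hilbert h.irrational) c (α₀ t)
    convert this using 1
    funext p
    ring
  · rw [torusDeriv_along, jacobian]
  · rw [torusDeriv_add_const, torusDeriv_const_mul, torusDeriv_along, mul_div_assoc]
  · have h1 : ∀ p, tangent k ξ (along k (α₀ t) p) * (-(c * (m - tangent k ξ (along k (α₀ t) p) /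
        jacobian k ξ η (along k (α₀ t) p))) + (c * m - deriv α₀ t)) -
        torusDeriv k (fun q => η (along k (α₀ t) q)) p * (-(c * (torusDeriv k η (along k (α₀ t) p) /
        jacobian k ξ η (along k (α₀ t) p)))) =
        c - deriv α₀ t * tangent k ξ (along k (α₀ t) p) := fun p => by
      rw [torusDeriv_along, h.drift_eq]
    -- The tangent has mean `1`, so the mean here is `c - α₀'`, the derivative of `x₀ = c t - α₀`.
    simp only [h1]
    rw [h.torusMean_const_sub_tangent]
    exact (((hasDerivAt_id t).const_mul c).sub (hα' t)).congr_deriv (by ring)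
  · rw [torusDeriv_along, h.kinematic_eq]
    exact hasDerivAt_along h.analytic (hα' t) p
  · have h1 : torusDeriv k (fun q => tangent k ξ (along k (α₀ t) q)) p =
        torusDeriv k (tangent k ξ) (along k (α₀ t) p) := torusDeriv_along _ _ _
    have h2 : torusDeriv k (fun q => η (along k (α₀ t) q)) =
        fun q => torusDeriv k η (along k (α₀ t) q) := funext fun q => torusDeriv_along _ _ _
    rw [torusDeriv_add_const, torusDeriv_const_mul, torusDeriv_const_mul, torusDeriv_along,
      torusDeriv_along, h1, h2, torusDeriv_along, h.dynamic_eq]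
  -- The derivative of `ξ` has mean zero, so the projection `P` removes exactly the constant `c² / 2
  -- - K` and leaves `-α₀' φ_α`.
  · have h1 : ∀ p, c ^ 2 / 2 - K - deriv α₀ t * (c * torusDeriv k ξ (along k (α₀ t) p)) =
        (c ^ 2 / 2 - K + deriv α₀ t * c) -
          (deriv α₀ t * c) * tangent k ξ (along k (α₀ t) p) := fun p => by
      rw [tangent]; ring
    have h2 : torusMean (fun p => c ^ 2 / 2 - K -
        deriv α₀ t * (c * torusDeriv k ξ (along k (α₀ t) p))) = c ^ 2 / 2 - K := by
      simp only [h1]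
      rw [h.torusMean_const_sub_tangent]
      ring
    rw [h2]
    refine ((hasDerivAt_along h.analytic_xi (hα' t) p).const_mul c).congr_deriv ?_
    ring

theorem solvesLine (h : WaveProfile k c g τ ξ η m K) {α₀ : ℝ → ℝ} (hα : Differentiable ℝ α₀)
    (θ : ℝ) {ζ : ℝ → ℝ → ℂ} {φ : ℝ → ℝ → ℝ}
    (hre : ∀ t α, (ζ t α).re = α + (ξ (along k (α₀ t) (α, θ + k * α)) + (c * t - α₀ t)))
    (him : ∀ t α, (ζ t α).im = η (along k (α₀ t) (α, θ + k * α)))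
    (hφ : ∀ t α, φ t α = c * ξ (along k (α₀ t) (α, θ + k * α))) :
    SolvesLine k g τ (fun t => c * m - deriv α₀ t) ζ φ := by
  have hT := h.torusSystem hα
  obtain ⟨y, hy, -⟩ := h.quotient
  have key := hT.lineSystem (fun t => ⟨_, ((hasFourierSeries_along (k := k) hy (α₀ t)).const_mul
      c).congr_fun fun p => by push_cast; rfl⟩) (fun t => ?_) (fun t => ?_) θ
  · unfold SolvesLine
    rw [show (fun t α => (ζ t α).re) = _ from funext₂ hre,
      show (fun t α => (ζ t α).im) = _ from funext₂ him, show φ = _ from funext₂ hφ]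
    exact ⟨_, _, _, _, _, _, key⟩
  · have h1 : (fun p => tangent k ξ (along k (α₀ t) p) * (-(c * (m - tangent k ξ (along k (α₀ t) p) /
        jacobian k ξ η (along k (α₀ t) p))) + (c * m - deriv α₀ t)) -
        torusDeriv k (fun q => η (along k (α₀ t) q)) p * (-(c * (torusDeriv k η (along k (α₀ t) p) /
        jacobian k ξ η (along k (α₀ t) p))))) =
        fun p => c - deriv α₀ t * tangent k ξ (along k (α₀ t) p) := funext fun p => by
      rw [torusDeriv_along, h.drift_eq]
    obtain ⟨b, -, hu⟩ := h.hasFourierSeries_const_sub_tangent c (deriv α₀ t) (α₀ t)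
    rw [h1]
    exact ⟨hu.continuous_real, hu.periodic.torusPeriodic⟩
  · have h1 : (fun p => c ^ 2 / 2 - K - deriv α₀ t * (c * torusDeriv k ξ (along k (α₀ t) p))) =
        fun p => (c ^ 2 / 2 - K + deriv α₀ t * c) -
          (deriv α₀ t * c) * tangent k ξ (along k (α₀ t) p) := funext fun p => by
      rw [tangent]; ring
    obtain ⟨b, -, hu⟩ := h.hasFourierSeries_const_sub_tangent (c ^ 2 / 2 - K + deriv α₀ t * c)
      (deriv α₀ t * c) (α₀ t)
    rw [h1]
    exact ⟨hu.continuous_real, hu.periodic.torusPeriodic⟩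

theorem solvesTorus (h : WaveProfile k c g τ ξ η m K) {α₀ : ℝ → ℝ} (hα : Differentiable ℝ α₀)
    {ζ : ℝ → ℝ × ℝ → ℂ} {φ : ℝ → ℝ × ℝ → ℝ}
    (hre : ∀ t p, (ζ t p).re = ξ (along k (α₀ t) p) + (c * t - α₀ t))
    (him : ∀ t p, (ζ t p).im = η (along k (α₀ t) p))
    (hφ : ∀ t p, φ t p = c * ξ (along k (α₀ t) p)) :
    SolvesTorus k g τ (fun t => c * m - deriv α₀ t) ζ φ := by
  unfold SolvesTorus
  rw [show (fun t p => (ζ t p).re) = _ from funext₂ hre,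
    show (fun t p => (ζ t p).im) = _ from funext₂ him, show φ = _ from funext₂ hφ]
  exact ⟨_, _, _, _, _, _, _, h.torusSystem hα⟩

end WaveProfile

/-! ### From the hypotheses to a wave profile. -/

lemma HasFourierSeries.ofReal_add_I_mul {k : ℝ} {a : ℤ × ℤ → ℂ} {u v : ℝ × ℝ → ℝ}
    (hu : HasFourierSeries a fun p => (u p : ℂ))
    (hv : HasFourierSeries (fun j => hilbertSymbol k j * a j) fun p => (v p : ℂ)) :
    HasFourierSeries (fun j => (hilbertSymbol k j + Complex.I) * a j)
      fun p => (v p : ℂ) + Complex.I * (u p : ℂ) :=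
  (hv.add (hu.const_mul Complex.I)).congr_coeff fun j => by ring

/-- The coefficients of `H[η] + i η` carry this factor, so positive frequencies are absent from
`ζ̃₀`. -/
lemma hilbertSymbol_add_I_of_pos {k : ℝ} {j : ℤ × ℤ} (hj : 0 < freq k j) :
    hilbertSymbol k j + Complex.I = 0 := by
  simp [hilbertSymbol, Real.sign_of_pos hj]

lemma norm_hilbertSymbol_add_I_le (k : ℝ) (j : ℤ × ℤ) :
    ‖hilbertSymbol k j + Complex.I‖ ≤ 2 * weight j := by
  refine (norm_add_le _ _).trans ?_
  rw [Complex.norm_I]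
  linarith [norm_hilbertSymbol_le k j, one_le_weight j]

/-- The reciprocal tangent has real part `ξ_α / J` and imaginary part `-η_α / J`; conjugacy of these
is the field `quotient`. The Bernoulli constant is the mean of the traveling wave expression. -/
theorem exists_waveProfile {k c g τ : ℝ} (hk : Irrational k) {ξ η : ℝ × ℝ → ℝ} {ζ : ℝ × ℝ → ℂ}
    (hη : TorusAnalytic η) (htrav : TorusTraveling k c g τ η) (hξ : IsTorusHilbert k η ξ)
    (hζ : ∀ p, ζ p = (ξ p : ℂ) + Complex.I * (η p : ℂ))
    (hinj : ∀ θ, Function.Injective (lineCurve k ζ θ))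
    (hreg : ∀ θ α : ℝ, deriv (lineCurve k ζ θ) α ≠ 0) :
    ∃ y K, HasFourierSeries y (fun p => ((tangent k ξ p / jacobian k ξ η p : ℝ) : ℂ)) ∧
      WaveProfile k c g τ ξ η (torusMean fun p => tangent k ξ p / jacobian k ξ η p) K := by
  obtain ⟨a, ha, hu⟩ := hη.exists_hasFourierSeries
  have hv := hξ.hasFourierSeries hu
  have hva : RapidDecay fun j => hilbertSymbol k j * a j :=
    ha.mul_bounded (norm_hilbertSymbol_le k)
  have hDu := hu.torusDeriv (k := k) ha
  have hDv := hv.torusDeriv (k := k) hva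
  have hb : RapidDecay fun j => (hilbertSymbol k j + Complex.I) * a j :=
    ha.mul (norm_hilbertSymbol_add_I_le k)
  have hζF : HasFourierSeries (fun j => (hilbertSymbol k j + Complex.I) * a j) ζ :=
    (hu.ofReal_add_I_mul hv).congr_fun hζ
  have hD : HasFourierSeries
      (fun j => Complex.I * freq k j * ((hilbertSymbol k j + Complex.I) * a j))
      (fun p => (torusDeriv k ξ p : ℂ) + Complex.I * (torusDeriv k η p : ℂ)) :=
    (hDu.ofReal_add_I_mul (hDv.congr_coeff fun j => by ring)).congr_coeff fun j => by ring
  have hline : ∀ θ s : ℝ, (0, θ) + s • ((1, k) : ℝ × ℝ) = (s, θ + k * s) := fun θ s => by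
    simp [mul_comm]
  have hreg' : ∀ p, 1 + ((torusDeriv k ξ p : ℂ) + Complex.I * (torusDeriv k η p : ℂ)) ≠ 0 := by
    intro p
    -- Every point of the plane lies on the line with phase `p.2 - k * p.1`, at parameter `p.1`.
    -- Line hypotheses for all phases thus become statements on the whole torus.
    have h := hreg (p.2 - k * p.1) p.1
    have h1 := (Complex.ofRealCLM.hasDerivAt (x := p.1)).add
      (hζF.hasDerivAt_line hb hD (0, p.2 - k * p.1) p.1)
    simp only [hline, sub_add_cancel] at h1
    have h2 : HasDerivAt (lineCurve k ζ (p.2 - k * p.1)) _ p.1 := h1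
    rw [h2.deriv] at h
    simpa using h
  have hinj' : ∀ (p : ℝ × ℝ) (u : ℝ), u ≠ 0 → (u : ℂ) + ζ (p + u • (1, k)) - ζ p ≠ 0 := by
    intro p u hu0 h
    have h1 : lineCurve k ζ (p.2 - k * p.1) (p.1 + u) = lineCurve k ζ (p.2 - k * p.1) p.1 := by
      have e1 : (p.1 + u, p.2 - k * p.1 + k * (p.1 + u)) = p + u • ((1, k) : ℝ × ℝ) := by
        ext <;> simp; ring
      have e2 : (p.1, p.2 - k * p.1 + k * p.1) = p := by ext <;> simp
      unfold lineCurve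
      rw [e1, e2]
      push_cast
      linear_combination h
    exact hu0 (by simpa using hinj _ h1)
  obtain ⟨w, hw, hw0⟩ := exists_hasFourierSeries_inv hb
    (fun j hj => by rw [hilbertSymbol_add_I_of_pos hj, zero_mul]) hζF hD hinj' hreg'
  have hnorm : ∀ p, Complex.normSq
      (1 + ((torusDeriv k ξ p : ℂ) + Complex.I * (torusDeriv k η p : ℂ))) =
      jacobian k ξ η p := fun p => by
    simp [Complex.normSq_apply, jacobian, tangent, sq]
  have hre : ∀ p, ((1 + ((torusDeriv k ξ p : ℂ) + Complex.I * (torusDeriv k η p : ℂ)))⁻¹).re =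
      tangent k ξ p / jacobian k ξ η p := fun p => by
    rw [Complex.inv_re, hnorm]; simp [tangent]
  have him : ∀ p, ((1 + ((torusDeriv k ξ p : ℂ) + Complex.I * (torusDeriv k η p : ℂ)))⁻¹).im =
      -(torusDeriv k η p / jacobian k ξ η p) := fun p => by
    rw [Complex.inv_im, hnorm]; simp [neg_div]
  have hR := hw.re
  have hI := hw.im
  have hH := hw.hilbert_im hk hw0
  simp only [hre, him] at hR hI hH
  obtain ⟨X, B, hX, hB, hB0⟩ := htrav
  -- Both `X - 1` and the derivative of `ξ` are sums of the series with multiplier `H` composed with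
  -- the derivative, because the two symbols commute.
  have hX' : X = tangent k ξ := by
    funext p
    have h1 := congrFun ((hX.hasFourierSeries hDu).unique
      (hDv.congr_coeff fun j => by ring)) p
    simp only [Complex.ofReal_inj] at h1
    rw [tangent, ← h1]
    ring
  subst hX'
  refine ⟨_, torusMean B, hR, hk, hη, hξ, fun p => ?_,
    ⟨_, (hI.const_mul (-1)).congr_fun fun p => ?_, ?_⟩, fun p => ?_⟩
  · rw [← hnorm]
    exact (Complex.normSq_pos.2 (hreg' p)).ne'
  · push_cast; ring
  · refine ((hH.const_mul (-1)).congr_coeff fun j => ?_).congr_fun fun p => ?_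
    · ring
    · push_cast; ring
  · rw [← sub_eq_zero.1 (hB0 p), hB p, jacobian]

lemma lineCurve_toIcoMod {k : ℝ} {ζ : ℝ × ℝ → ℂ} (hζ : CPeriodic ζ) (θ : ℝ) :
    lineCurve k ζ (toIcoMod Real.two_pi_pos 0 θ) = lineCurve k ζ θ := by
  funext α
  have h := (show Function.Periodic (fun y => ζ (α, y)) (2 * Real.pi) from
    fun y => (hζ α y).2).sub_zsmul_eq (x := θ + k * α) (toIcoDiv Real.two_pi_pos 0 θ)
  simp only [lineCurve, toIcoMod]
  rw [← h]
  congr 3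
  ring

end QPWave

end

/-! ### The main theorem. -/

theorem mainTheorem2
    (k c g τ : ℝ) (hk : 0 < k) (hk_irr : Irrational k)
    (η₀ ξ₀ φ₀ : ℝ × ℝ → ℝ) (ζ₀ : ℝ × ℝ → ℂ)
    (hη₀ : QPWave.TorusAnalytic η₀)
    (htrav : QPWave.TorusTraveling k c g τ η₀)
    (hξ₀ : QPWave.IsTorusHilbert k η₀ ξ₀)
    (hζ₀ : ∀ p, ζ₀ p = (ξ₀ p : ℂ) + Complex.I * (η₀ p : ℂ))
    (hφ₀ : ∀ p, φ₀ p = c * ξ₀ p)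
    (hinj : ∀ θ ∈ Set.Ico 0 (2 * Real.pi), Function.Injective (QPWave.lineCurve k ζ₀ θ))
    (hreg : ∀ θ ∈ Set.Ico 0 (2 * Real.pi), ∀ α : ℝ, deriv (QPWave.lineCurve k ζ₀ θ) α ≠ 0)
    (α₀ : ℝ → ℝ) (hα₀ : ContDiff ℝ 1 α₀)
    (ζ : ℝ → ℝ → ℝ → ℂ) (φ : ℝ → ℝ → ℝ → ℝ)
    (hζ : ∀ θ t α : ℝ, ζ θ t α = QPWave.lineCurve k ζ₀ θ (α - α₀ t) + ((c * t : ℝ) : ℂ))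
    (hφ : ∀ θ t α : ℝ, φ θ t α = QPWave.lineFun k φ₀ θ (α - α₀ t))
    (ζT : ℝ → ℝ × ℝ → ℂ) (φT : ℝ → ℝ × ℝ → ℝ)
    (hζT : ∀ (t : ℝ) (p : ℝ × ℝ),
      ζT t p = ζ₀ (p.1 - α₀ t, p.2 - k * α₀ t) + ((c * t - α₀ t : ℝ) : ℂ))
    (hφT : ∀ (t : ℝ) (p : ℝ × ℝ), φT t p = φ₀ (p.1 - α₀ t, p.2 - k * α₀ t)) :
    ∃ C₁ : ℝ → ℝ,
      (∀ θ t : ℝ, ∃ m : ℝ, QPWave.HasMean k (QPWave.lineXiOverJ (ζ θ t)) m ∧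
        C₁ t = c * m - deriv α₀ t) ∧
      (∀ t : ℝ, C₁ t = c * QPWave.torusMean (QPWave.torusXiOverJ k (ζT t)) - deriv α₀ t) ∧
      (∀ θ : ℝ, QPWave.SolvesLine k g τ C₁ (ζ θ) (φ θ)) ∧
      QPWave.SolvesTorus k g τ C₁ ζT φT ∧
      (∀ θ t α : ℝ, ζ θ t α = QPWave.lineCurve k (ζT t) θ α ∧
        φ θ t α = QPWave.lineFun k (φT t) θ α) := by
  have hper : QPWave.CPeriodic ζ₀ := by
    obtain ⟨a, -, hu⟩ := hη₀.exists_hasFourierSeries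
    exact ((hu.ofReal_add_I_mul (hξ₀.hasFourierSeries hu)).congr_fun hζ₀).periodic
  -- The curves depend on `θ` only modulo `2π`, so the hypotheses on `[0, 2π)` extend to all phases.
  have hmod : ∀ θ : ℝ, toIcoMod Real.two_pi_pos 0 θ ∈ Set.Ico 0 (2 * Real.pi) :=
    toIcoMod_mem_Ico' Real.two_pi_pos
  obtain ⟨y, K, hR, hW⟩ := QPWave.exists_waveProfile hk_irr hη₀ htrav hξ₀ hζ₀
    (fun θ => by rw [← QPWave.lineCurve_toIcoMod hper]; exact hinj _ (hmod θ))
    (fun θ => by rw [← QPWave.lineCurve_toIcoMod hper]; exact hreg _ (hmod θ))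
  have hα : Differentiable ℝ α₀ := hα₀.differentiable one_ne_zero
  have hreT : ∀ t p, (ζT t p).re =
      ξ₀ (QPWave.WaveProfile.along k (α₀ t) p) + (c * t - α₀ t) := fun t p => by
    rw [hζT, hζ₀, QPWave.WaveProfile.along_eq]; simp
  have himT : ∀ t p, (ζT t p).im = η₀ (QPWave.WaveProfile.along k (α₀ t) p) := fun t p => by
    rw [hζT, hζ₀, QPWave.WaveProfile.along_eq]; simp
  have hφT' : ∀ t p, φT t p = c * ξ₀ (QPWave.WaveProfile.along k (α₀ t) p) := fun t p => by
    rw [hφT, hφ₀, QPWave.WaveProfile.along_eq]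
  have hcorr : ∀ θ t α : ℝ, ζ θ t α = QPWave.lineCurve k (ζT t) θ α ∧
      φ θ t α = QPWave.lineFun k (φT t) θ α := by
    intro θ t α
    have he : (α - α₀ t, θ + k * (α - α₀ t)) = (α - α₀ t, θ + k * α - k * α₀ t) := by
      congr 1; ring
    constructor
    · simp only [hζ, QPWave.lineCurve, hζT, he]
      push_cast
      ring
    · simp only [hφ, QPWave.lineFun, hφT, he]
  have hre : ∀ θ t α, (ζ θ t α).re =
      α + (ξ₀ (QPWave.WaveProfile.along k (α₀ t) (α, θ + k * α)) + (c * t - α₀ t)) := by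
    intro θ t α
    rw [(hcorr θ t α).1, QPWave.lineCurve, Complex.add_re, hreT, Complex.ofReal_re]
  have him : ∀ θ t α, (ζ θ t α).im =
      η₀ (QPWave.WaveProfile.along k (α₀ t) (α, θ + k * α)) := by
    intro θ t α
    rw [(hcorr θ t α).1, QPWave.lineCurve, Complex.add_im, himT, Complex.ofReal_im, zero_add]
  have hφ' : ∀ θ t α, φ θ t α =
      c * ξ₀ (QPWave.WaveProfile.along k (α₀ t) (α, θ + k * α)) := by
    intro θ t α
    rw [(hcorr θ t α).2, QPWave.lineFun, hφT']
  have hRs : ∀ t, QPWave.HasFourierSeries _ _ := fun t =>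
    QPWave.WaveProfile.hasFourierSeries_along (k := k) hR (α₀ t)
  have hRm : ∀ t, _ = _ := fun t => QPWave.WaveProfile.torusMean_along (k := k) hR (α₀ t)
  -- Unification sets `C₁ t = c * m - deriv α₀ t` with `m` the mean for the unshifted profile. The
  -- mean is invariant under the translation by `α₀ t` and under the phase `θ`, so the same number
  -- serves at all times and on all lines.
  refine ⟨_, fun θ t => ⟨_, ?_, rfl⟩, fun t => ?_,
    fun θ => hW.solvesLine hα θ (hre θ) (him θ) (hφ' θ), hW.solvesTorus hα hreT himT hφT', hcorr⟩
  · have hξd : deriv (fun a => (ζ θ t a).re) = fun α => QPWave.tangent k ξ₀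
        (QPWave.WaveProfile.along k (α₀ t) (α, θ + k * α)) := by
      funext α
      have h1 := ((hW.analytic_xi.shift (-(α₀ t) • (1, k))).add
        (QPWave.TorusAnalytic.const (c * t - α₀ t))).deriv_add_line k θ α
      simp only [hre θ t]
      refine h1.trans ?_
      rw [QPWave.torusDeriv_add_const, QPWave.torusDeriv_shift]
      rfl
    have hηd : deriv (fun a => (ζ θ t a).im) = fun α => QPWave.torusDeriv k η₀
        (QPWave.WaveProfile.along k (α₀ t) (α, θ + k * α)) := by
      funext α
      simp only [him θ t]
      exact (QPWave.deriv_line k (fun p => η₀ (QPWave.WaveProfile.along k (α₀ t) p)) θ α).trans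
        (QPWave.WaveProfile.torusDeriv_along _ _ _)
    have hQ : QPWave.lineXiOverJ (ζ θ t) = fun α =>
        (fun p => QPWave.tangent k ξ₀ p / QPWave.jacobian k ξ₀ η₀ p)
          (QPWave.WaveProfile.along k (α₀ t) (α, θ + k * α)) := by
      funext α
      rw [QPWave.lineXiOverJ, hξd, hηd]
      rfl
    rw [hQ, ← hRm t]
    exact QPWave.hasMean_line (hRs t).continuous_real
      (hRs t).periodic.torusPeriodic k θ
  · have hQ : QPWave.torusXiOverJ k (ζT t) = fun p =>
        (fun p => QPWave.tangent k ξ₀ p / QPWave.jacobian k ξ₀ η₀ p)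
          (QPWave.WaveProfile.along k (α₀ t) p) := by
      funext p
      have h1 : QPWave.torusDeriv k (fun q => (ζT t q).re) p =
          QPWave.torusDeriv k ξ₀ (QPWave.WaveProfile.along k (α₀ t) p) := by
        simp only [hreT]
        rw [QPWave.torusDeriv_add_const, QPWave.WaveProfile.torusDeriv_along]
      have h2 : QPWave.torusDeriv k (fun q => (ζT t q).im) p =
          QPWave.torusDeriv k η₀ (QPWave.WaveProfile.along k (α₀ t) p) := by
        simp only [himT]
        rw [QPWave.WaveProfile.torusDeriv_along]
      rw [QPWave.torusXiOverJ, h1, h2]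
      rfl
    rw [hQ, hRm t]
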